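/- Let $\mathcal M$ be a smooth (finite-dimensional, without boundary) Riemannian manifold that is complete for its Riemannian distance, let $\mathcal E$ be a Euclidean space, and let $\varphi:\mathcal M\to\mathcal E$ be smooth with image $\mathcal X=\varphi(\mathcal M)$. Let $f$ be a real function that is three times continuously differentiable on an open neighborhood of $\mathcal X$ in $\mathcal E$, and put $g=f\circ\varphi:\mathcal M\to\mathbb R$. Let $\mathrm R:\mathrm T\mathcal M\to\mathcal M$ be a retraction: a smooth map such that for all $y\in\mathcal M$ and $u\in \mathrm T_y\mathcal M$ the curve $c(t)=\mathrm R_y(tu)$ satisfies $c(0)=y$ and $c'(0)=u$. Let $\Phi:\mathcal M\to\mathcal M$ be a rebalancing map for $\varphi$: (a) $\varphi\circ\Phi=\varphi$, and (b) $\Phi(\varphi^{-1}(B))$ is bounded for every bounded $B\subseteq\mathcal X$. (Boundedness in $\mathcal M$ refers to the Riemannian distance; if $\mathcal M$ is not connected, it means being contained in a finite union of balls of finite radius.) $\Phi$ need not be continuous. For $y\in\mathcal M$ let $\hat g_y=g\circ\mathrm R_y:\mathrm T_y\mathcal M\to\mathbb R$, let $\lambda(y)$ be the least eigenvalue of $\nabla^2\hat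 g_y(0)$ (with $\lambda(y)=0$ if $\dim\mathcal M=0$), let $\lambda(y)_-=\min(\lambda(y),0)$, and let $$m_y(s)=g(y)+\langle s,\nabla\hat g_y(0)\rangle+\tfrac12\langle s,\nabla^2\hat g_y(0)[s]\rangle .$$ Consider the following algorithm, with parameters $\gamma_c,\eta\in(0,1)$ and $0<\underline\gamma\le\overline\gamma<\infty$, and with input $y_{\mathrm{in}}\in\mathcal M$ and $\gamma_0\in[\underline\gamma,\overline\gamma]$. Set $y_0=\Phi(y_{\mathrm{in}})$. For $k=0,1,2,\dots$: 1. If $\lambda(y_k)<0$ and $\|\nabla g(y_k)\|^2<|\lambda(y_k)_-|^3$, set $\delta_k=\gamma_k|\lambda(y_k)_-|$ and let $u_k$ be a unit eigenvector of $\nabla^2\hat g_{y_k}(0)$ for $\lambda(y_k)$ with $\langle u_k,\nabla g(y_k)\rangle\le0$. Otherwise set $\delta_k=\gamma_k\|\nabla g(y_k)\|$ and $u_k=-\nabla g(y_k)$. 2. Let $s_k^c=t_ku_k$, where $t_k$ minimizes $m_{y_k}(tu_k)$ over all $t\ge0$ with $\|tu_k\|\le\delta_k$, and choose any $s_k\in\mathrm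 T_{y_k}\mathcal M$ with $\|s_k\|\le\delta_k$ and $m_{y_k}(s_k)\le m_{y_k}(s_k^c)$. 3. Let $\rho_k=\dfrac{g(y_k)-g(\mathrm R_{y_k}(s_k))}{m_{y_k}(0)-m_{y_k}(s_k)}$, or $\rho_k=1$ if the denominator is zero. 4. If $\rho_k\ge\eta$, set $y_{k+1}=\Phi(\mathrm R_{y_k}(s_k))$ and choose any $\gamma_{k+1}\in[\underline\gamma,\overline\gamma]$. Otherwise set $y_{k+1}=y_k$ and $\gamma_{k+1}=\gamma_c\gamma_k$. Let $x_0\in\mathcal X$ be such that the sublevel set $\{x\in\mathcal X: f(x)\le f(x_0)\}$ is bounded, and let $y_{\mathrm{in}}\in\varphi^{-1}(x_0)$. Then the algorithm can be run indefinitely from $y_{\mathrm{in}}$, and every sequence $(y_k)_{k\ge0}$ it produces (whatever the choices made) has at least one accumulation point (a limit of a subsequence). Moreover, every accumulation point $y$ is 2-critical for $g$: for every smooth curve $c:\mathbb R\to\mathcal M$ with $c(0)=y$, one has $(g\circ c)'(0)=0$ and $(g\circ c)''(0)\ge0$. -/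

import Mathlib

open scoped Manifold ContDiff Bundle Topology NNReal

noncomputable section

namespace HookedTrustRegion

section Riemannian

variable {EM : Type*} [NormedAddCommGroup EM] [NormedSpace ℝ EM] [FiniteDimensional ℝ EM]
  {M : Type*} [EMetricSpace M] [ChartedSpace EM M]

instance finiteDimensional_tangentSpace (y : M) :
    FiniteDimensional ℝ (TangentSpace 𝓘(ℝ, EM) y) :=
  inferInstanceAs (FiniteDimensional ℝ EM)

variable [IsManifold 𝓘(ℝ, EM) ∞ M]
  [Bundle.RiemannianBundle (fun x : M ↦ TangentSpace 𝓘(ℝ, EM) x)]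

instance completeSpace_tangentSpace (y : M) : CompleteSpace (TangentSpace 𝓘(ℝ, EM) y) :=
  FiniteDimensional.complete ℝ _

/-- The Riemannian gradient `∇g(y)`: the tangent vector representing the differential of `g`
at `y` through the Riemannian inner product on the tangent space. -/
def riemannianGradient (EM : Type*) [NormedAddCommGroup EM] [NormedSpace ℝ EM]
    [FiniteDimensional ℝ EM] {M : Type*} [EMetricSpace M] [ChartedSpace EM M]
    [IsManifold 𝓘(ℝ, EM) ∞ M] [Bundle.RiemannianBundle (fun x : M ↦ TangentSpace 𝓘(ℝ, EM) x)]
    (g : M → ℝ) (y : M) : TangentSpace 𝓘(ℝ, EM) y :=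
  (InnerProductSpace.toDual ℝ (TangentSpace 𝓘(ℝ, EM) y)).symm
    (mfderiv 𝓘(ℝ, EM) 𝓘(ℝ, ℝ) g y : TangentSpace 𝓘(ℝ, EM) y →L[ℝ] ℝ)

/-- A retraction: a smooth map `R` from the tangent bundle to the manifold such that every curve
`c(t) = R_y(t u)` satisfies `c(0) = y` and `c'(0) = u`. -/
structure IsRetraction (R : TangentBundle 𝓘(ℝ, EM) M → M) : Prop where
  smooth : ContMDiff (𝓘(ℝ, EM)).tangent 𝓘(ℝ, EM) ∞ R
  -- equality in the tangent bundle: of base points (`c(0) = y`) and of vectors (`c'(0) = u`)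
  tangent : ∀ (y : M) (u : TangentSpace 𝓘(ℝ, EM) y),
    tangentMap 𝓘(ℝ, ℝ) 𝓘(ℝ, EM) (fun t : ℝ ↦ R ⟨y, t • u⟩) ⟨0, (1 : ℝ)⟩ = ⟨y, u⟩

/-- The pullback `ĝ_y = g ∘ R_y`, a function on the Euclidean space `T_y M`. -/
def pullback (g : M → ℝ) (R : TangentBundle 𝓘(ℝ, EM) M → M) (y : M) :
    TangentSpace 𝓘(ℝ, EM) y → ℝ :=
  fun s ↦ g (R ⟨y, s⟩)

/-- The Hessian `∇²ĝ_y(0)` of the pullback at the origin, as a linear operator on `T_y M`. -/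
def pullbackHessian (g : M → ℝ) (R : TangentBundle 𝓘(ℝ, EM) M → M) (y : M) :
    TangentSpace 𝓘(ℝ, EM) y →L[ℝ] TangentSpace 𝓘(ℝ, EM) y :=
  fderiv ℝ (gradient (pullback g R y)) 0

/-- The quadratic model `m(s) = g(y) + ⟨s, ∇ĝ_y(0)⟩ + ½ ⟨s, ∇²ĝ_y(0)[s]⟩`. -/
def model (g : M → ℝ) (R : TangentBundle 𝓘(ℝ, EM) M → M) (y : M)
    (s : TangentSpace 𝓘(ℝ, EM) y) : ℝ :=
  g y + inner ℝ s (gradient (pullback g R y) 0) + 1 / 2 * inner ℝ s (pullbackHessian g R y s)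

/-- The left-most eigenvalue `λ` of the Hessian `∇²ĝ_y(0)` (it is `0` if `T_y M` is trivial, where
there is no eigenvalue). -/
def leastEigenvalue (g : M → ℝ) (R : TangentBundle 𝓘(ℝ, EM) M → M) (y : M) : ℝ :=
  sInf {μ : ℝ | Module.End.HasEigenvalue
    (pullbackHessian g R y : Module.End ℝ (TangentSpace 𝓘(ℝ, EM) y)) μ}

/-- The test deciding the type of an iteration: it is an iteration on the eigenvalue if `λ < 0` and
`‖∇g(y)‖² < |λ₋|³`, and an iteration on the gradient otherwise. -/
def IsEigenvalueStep (g : M → ℝ) (R : TangentBundle 𝓘(ℝ, EM) M → M) (y : M) : Prop :=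
  leastEigenvalue g R y < 0 ∧
    ‖riemannianGradient EM g y‖ ^ 2 < |min (leastEigenvalue g R y) 0| ^ 3

open Classical in
/-- The trust-region radius `δ`. -/
def radius (g : M → ℝ) (R : TangentBundle 𝓘(ℝ, EM) M → M) (y : M) (γ : ℝ) : ℝ :=
  if IsEigenvalueStep g R y then γ * |min (leastEigenvalue g R y) 0|
  else γ * ‖riemannianGradient EM g y‖

/-- `u` is a direction defining the Cauchy step: `-∇g(y)` in an iteration on the gradient, and in an
iteration on the eigenvalue a unit eigenvector for the least eigenvalue whose inner product
with `∇g(y)` is at most `0`. -/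
def IsCauchyDirection (g : M → ℝ) (R : TangentBundle 𝓘(ℝ, EM) M → M) (y : M)
    (u : TangentSpace 𝓘(ℝ, EM) y) : Prop :=
  (IsEigenvalueStep g R y →
    ‖u‖ = 1 ∧ pullbackHessian g R y u = leastEigenvalue g R y • u ∧
      inner ℝ u (riemannianGradient EM g y) ≤ 0) ∧
  (¬ IsEigenvalueStep g R y → u = -riemannianGradient EM g y)

/-- `sc` is a Cauchy step: `sc = t u` for a Cauchy direction `u`, where `t` minimizes `m(t u)` among
all `t ≥ 0` with `‖t u‖ ≤ δ`. -/
def IsCauchyStep (g : M → ℝ) (R : TangentBundle 𝓘(ℝ, EM) M → M) (y : M) (γ : ℝ)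
    (sc : TangentSpace 𝓘(ℝ, EM) y) : Prop :=
  ∃ (u : TangentSpace 𝓘(ℝ, EM) y) (t : ℝ), IsCauchyDirection g R y u ∧ sc = t • u ∧
    0 ≤ t ∧ ‖t • u‖ ≤ radius g R y γ ∧
    ∀ t' : ℝ, 0 ≤ t' → ‖t' • u‖ ≤ radius g R y γ → model g R y (t • u) ≤ model g R y (t' • u)

/-- An admissible trial step `s`: `‖s‖ ≤ δ` and `m(s) ≤ m(sc)` for a Cauchy step `sc`. -/
def IsTrialStep (g : M → ℝ) (R : TangentBundle 𝓘(ℝ, EM) M → M) (y : M) (γ : ℝ)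
    (s : TangentSpace 𝓘(ℝ, EM) y) : Prop :=
  ‖s‖ ≤ radius g R y γ ∧
    ∃ sc : TangentSpace 𝓘(ℝ, EM) y, IsCauchyStep g R y γ sc ∧ model g R y s ≤ model g R y sc

open Classical in
/-- The ratio `ρ` of actual to model decrease, set to `1` if the denominator is zero. -/
def decreaseRatio (g : M → ℝ) (R : TangentBundle 𝓘(ℝ, EM) M → M) (y : M)
    (s : TangentSpace 𝓘(ℝ, EM) y) : ℝ :=
  if model g R y 0 - model g R y s = 0 then 1
  else (g y - g (R ⟨y, s⟩)) / (model g R y 0 - model g R y s)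

/-- The parameters of the algorithm: `γc, η ∈ (0, 1)` and `0 < γlo ≤ γhi < ∞`. -/
structure Parameters where
  γc : ℝ
  η : ℝ
  γlo : ℝ
  γhi : ℝ
  γc_mem : γc ∈ Set.Ioo (0 : ℝ) 1
  η_mem : η ∈ Set.Ioo (0 : ℝ) 1
  γlo_pos : 0 < γlo
  γlo_le : γlo ≤ γhi

/-- `(y_k)`, `(γ_k)`, `(s_k)` is a run of the hooked Riemannian trust-region method for minimizing
`g` with retraction `R`, hook `Φ` and parameters `P`, from the input point `yin` and the input
`γ₀ = γin`. The method leaves freedom in the choice of trial steps and, after a successful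
iteration, of the next `γ_k`; all choices are admitted. -/
structure IsRun (P : Parameters) (g : M → ℝ) (R : TangentBundle 𝓘(ℝ, EM) M → M) (Φ : M → M)
    (yin : M) (γin : ℝ) (y : ℕ → M) (γ : ℕ → ℝ) (s : ∀ k, TangentSpace 𝓘(ℝ, EM) (y k)) :
    Prop where
  y_zero : y 0 = Φ yin
  γ_zero : γ 0 = γin
  trial : ∀ k, IsTrialStep g R (y k) (γ k) (s k)
  success : ∀ k, P.η ≤ decreaseRatio g R (y k) (s k) →
    y (k + 1) = Φ (R ⟨y k, s k⟩) ∧ γ (k + 1) ∈ Set.Icc P.γlo P.γhi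
  failure : ∀ k, ¬ P.η ≤ decreaseRatio g R (y k) (s k) →
    y (k + 1) = y k ∧ γ (k + 1) = P.γc * γ k

end Riemannian

/-- `y` is 2-critical for `g`: along each smooth curve `c : ℝ → M` with `c(0) = y`, one has
`(g ∘ c)'(0) = 0` and `(g ∘ c)''(0) ≥ 0`. -/
def IsTwoCritical (EM : Type*) [NormedAddCommGroup EM] [NormedSpace ℝ EM]
    {M : Type*} [TopologicalSpace M] [ChartedSpace EM M] (g : M → ℝ) (y : M) : Prop :=
  ∀ c : ℝ → M, ContMDiff 𝓘(ℝ, ℝ) 𝓘(ℝ, EM) ∞ c → c 0 = y →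
    deriv (g ∘ c) 0 = 0 ∧ 0 ≤ deriv (deriv (g ∘ c)) 0

/-- Boundedness for the Riemannian distance, which is infinite between different components:
containment in finitely many balls of finite radius. If all distances are finite (`M` connected),
this is the usual notion. -/
def IsDistBounded {M : Type*} [EMetricSpace M] (S : Set M) : Prop :=
  ∃ (t : Finset M) (r : ℝ≥0), ∀ z ∈ S, ∃ x ∈ t, edist z x ≤ r

/-- `Φ` is a rebalancing map for `φ : M → E`: (a) `φ ∘ Φ = φ`, and (b) `Φ(φ⁻¹(B))` is bounded for
all bounded subsets `B` of the image of `φ`. -/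
structure IsRebalancingMap {M : Type*} [EMetricSpace M] {E : Type*} [NormedAddCommGroup E]
    (φ : M → E) (Φ : M → M) : Prop where
  comp_eq : φ ∘ Φ = φ
  bounded : ∀ B : Set E, B ⊆ Set.range φ → Bornology.IsBounded B →
    IsDistBounded (Φ '' (φ ⁻¹' B))

end HookedTrustRegion

end

/-! Accumulation points exist by compactness. The values `g (y k)` never increase, because
successful steps decrease `g` and the hook preserves it. So every iterate lies in the image under
`Φ` of the preimage of the bounded sublevel set. That image is bounded, hence relatively compact by
a metric form of Hopf–Rinow (`isCompact_closedEBall_of_intermediate`).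

Suppose an accumulation point `z` is not 2-critical. By `isTwoCritical_of_nonneg`, either the
gradient at `z` is nonzero or the pullback Hessian has a negative direction. Both persist
quantitatively near `z`, since in one chart of the tangent bundle all nearby pullbacks come from a
single C² function (`exists_local_model`). The model error is then small against the model decrease
for small `γ`, uniformly in the base point. Hence `exists_eventually_success`: near `z`, steps with
`γ` below a threshold succeed, and steps with `γ` bounded below have model decrease at least some `κ
> 0`.

In `IsRun.isTwoCritical_of_mapClusterPt`, rejections near `z` can therefore shrink `γ` only so far,
and a success must occur there. An iterate near `z` with value below `g z + η κ` thus leads to one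
with value below `g z`, whereas monotonicity and continuity of `g` keep all values at least `g z`.
Only the invariance of `g` under `Φ` enters here, so a discontinuous hook does no harm. -/

noncomputable section

set_option linter.unusedSectionVars false

namespace HookedTrustRegion

/-! ### Hopf–Rinow in metric form -/

section Length

open Metric Set

/-- In a complete locally compact extended metric space in which almost intermediate points exist,
closed balls of finite radius are compact (the metric form of the Hopf–Rinow theorem). -/
theorem isCompact_closedEBall_of_intermediate {X : Type*} [EMetricSpace X] [CompleteSpace X]
    [LocallyCompactSpace X]
    (hX : ∀ (x z : X) (r δ : ℝ≥0), 0 < δ → edist z x < r + δ →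
      ∃ w, edist w x ≤ r ∧ edist z w < δ) (x : X) (r : ℝ≥0) :
    IsCompact (closedEBall x (r : ENNReal)) := by
  set T : Set ℝ≥0 := {r | IsCompact (closedEBall x (r : ENNReal))} with hT
  have hmono : ∀ r ∈ T, ∀ r' ≤ r, r' ∈ T := fun r hr r' h ↦
    IsCompact.of_isClosed_subset hr isClosed_closedEBall
      (closedEBall_subset_closedEBall (by exact_mod_cast h))
  -- Points of the ball of radius `r` are within `δ'` of the compact ball of radius `r - δ / 2`,
  -- where `δ / 2 < δ' < δ`. A finite `(δ - δ')`-net of the smaller ball is thus a `δ`-net of the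
  -- larger one.
  have hlim : ∀ r, (∀ r' < r, r' ∈ T) → r ∈ T := by
    intro r hr
    refine TotallyBounded.isCompact_of_isClosed ?_ isClosed_closedEBall
    rw [EMetric.totallyBounded_iff]
    intro ε hε
    obtain ⟨δ, hδ0, hδ⟩ := ENNReal.lt_iff_exists_nnreal_btwn.1 hε
    have hδ0 : 0 < δ := by exact_mod_cast hδ0
    have hc : IsCompact (closedEBall x ((r - δ / 2 : ℝ≥0) : ENNReal)) := by
      -- Subtraction in `ℝ≥0` is truncated: for `r = 0` the smaller radius is again `0`, and the
      -- ball is a point.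
      rcases eq_or_ne r 0 with rfl | hr0
      · simp
      · exact hr _ (tsub_lt_self (pos_iff_ne_zero.2 hr0) (half_pos hδ0))
    obtain ⟨δ', hδδ', hδ'δ⟩ := exists_between (half_lt_self hδ0)
    have hδ'0 : 0 < δ' := (half_pos hδ0).trans hδδ'
    obtain ⟨t, ht, htc⟩ := EMetric.totallyBounded_iff.1 hc.totallyBounded ((δ - δ' : ℝ≥0) : ENNReal)
      (by exact_mod_cast tsub_pos_of_lt hδ'δ)
    refine ⟨t, ht, fun z hz ↦ ?_⟩
    obtain ⟨w, hw, hzw⟩ := hX x z (r - δ / 2) δ' hδ'0 (by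
      refine lt_of_le_of_lt (mem_closedEBall.1 hz) ?_
      norm_cast
      have h1 : r ≤ r - δ / 2 + δ / 2 := le_tsub_add
      have h2 : δ / 2 < δ' := hδδ'
      exact lt_of_le_of_lt h1 (by gcongr))
    obtain ⟨q, hq, hwq⟩ := Set.mem_iUnion₂.1 (htc hw)
    refine Set.mem_iUnion₂.2 ⟨q, hq, ?_⟩
    rw [mem_eball] at hwq ⊢
    calc edist z q ≤ edist z w + edist w q := edist_triangle _ _ _
      _ < δ' + (δ - δ' : ℝ≥0) := ENNReal.add_lt_add hzw hwq
      _ = δ := by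
        norm_cast
        exact add_tsub_cancel_of_le hδ'δ.le
      _ ≤ ε := hδ.le
  -- By local compactness a compact ball has a compact neighbourhood, which contains a
  -- `δ`-thickening of it and hence the ball of radius `r + δ / 2`.
  have hstep : ∀ r ∈ T, ∃ r' > r, r' ∈ T := by
    intro r hr
    obtain ⟨K, hK, hrK⟩ := exists_compact_superset hr
    obtain ⟨δ, hδ, hδK⟩ := IsCompact.exists_thickening_subset_open hr isOpen_interior hrK
    set δ' : ℝ≥0 := ⟨δ, hδ.le⟩ with hδ'
    have hδ'0 : 0 < δ' := hδ
    refine ⟨r + δ' / 2, lt_add_of_pos_right _ (half_pos hδ'0),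
      hK.of_isClosed_subset isClosed_closedEBall fun z hz ↦ interior_subset (hδK ?_)⟩
    obtain ⟨w, hw, hzw⟩ := hX x z r δ' hδ'0 (by
      refine lt_of_le_of_lt (mem_closedEBall.1 hz) ?_
      norm_cast
      gcongr
      exact half_lt_self hδ'0)
    refine (mem_thickening_iff_exists_edist_lt _ _).2 ⟨w, hw, ?_⟩
    rwa [ENNReal.ofReal, Real.toNNReal_of_nonneg hδ.le]
  by_contra hcon
  have hcon : r ∉ T := hcon
  have hb : BddAbove T := ⟨r, fun a ha ↦ le_of_not_gt fun h ↦ hcon (hmono a ha r h.le)⟩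
  have hne : T.Nonempty := ⟨0, by simp [hT]⟩
  have hs : sSup T ∈ T := hlim _ fun r' hr' ↦ by
    obtain ⟨a, ha, hra⟩ := exists_lt_of_lt_csSup hne hr'
    exact hmono a ha r' hra.le
  obtain ⟨r', hr', hr'T⟩ := hstep _ hs
  exact absurd (le_csSup hb hr'T) (not_le.2 hr')

end Length

/-! ### Second-order calculus on normed spaces -/

section Calculus

variable {W : Type*} [NormedAddCommGroup W] [NormedSpace ℝ W]

/-- Second order Taylor expansion, uniformly in the base point. -/
theorem exists_taylor_two_uniform {F : W → ℝ} {p : W} (hF : ContDiffAt ℝ 2 F p) {ε : ℝ}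
    (hε : 0 < ε) :
    ∃ r > 0, ∀ z ∈ Metric.ball p r, ∀ h ∈ Metric.ball (0 : W) r,
      |F (z + h) - (F z + fderiv ℝ F z h + 1 / 2 * fderiv ℝ (fderiv ℝ F) z h h)| ≤
        ε * ‖h‖ ^ 2 := by
  have h1 : ContDiffAt ℝ 1 (fderiv ℝ F) p := hF.fderiv_right (by norm_num)
  have h2 : ContinuousAt (fderiv ℝ (fderiv ℝ F)) p :=
    (h1.fderiv_right (m := 0) (by norm_num)).continuousAt
  have e1 : ∀ᶠ z in 𝓝 p, DifferentiableAt ℝ F z := by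
    filter_upwards [hF.eventually (by simp)] with z hz using hz.differentiableAt (by simp)
  have e2 : ∀ᶠ z in 𝓝 p, DifferentiableAt ℝ (fderiv ℝ F) z := by
    filter_upwards [h1.eventually (by simp)] with z hz using hz.differentiableAt (by simp)
  have e3 : ∀ᶠ z in 𝓝 p, dist (fderiv ℝ (fderiv ℝ F) z) (fderiv ℝ (fderiv ℝ F) p) < ε / 2 :=
    Metric.continuousAt_iff'.1 h2 _ (half_pos hε)
  obtain ⟨r, hr, hball⟩ := Metric.eventually_nhds_iff_ball.1 (e1.and (e2.and e3))
  refine ⟨r / 2, half_pos hr, fun z hz h hh ↦ ?_⟩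
  have hmem : ∀ t ∈ Set.Icc (0 : ℝ) 1, z + t • h ∈ Metric.ball p r := by
    intro t ht
    rw [Metric.mem_ball, dist_eq_norm] at hz ⊢
    rw [mem_ball_zero_iff] at hh
    have : ‖t • h‖ ≤ ‖h‖ := by
      rw [norm_smul, Real.norm_of_nonneg ht.1]
      exact mul_le_of_le_one_left (norm_nonneg _) ht.2
    calc ‖z + t • h - p‖ = ‖(z - p) + t • h‖ := by congr 1; abel
      _ ≤ ‖z - p‖ + ‖t • h‖ := norm_add_le _ _
      _ < r := by linarith
  have hz' : z ∈ Metric.ball p r := by simpa using hmem 0 (by simp)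
  set B := fderiv ℝ (fderiv ℝ F) z with hB
  -- Mean value inequality for the first derivative: on the ball the second derivative is within `ε
  -- / 2` of its value at `p`, hence within `ε` of `B`.
  have hD : ∀ w ∈ Metric.ball p r, ‖fderiv ℝ F w - fderiv ℝ F z - B (w - z)‖ ≤ ε * ‖w - z‖ := by
    intro w hw
    refine (convex_ball p r).norm_image_sub_le_of_norm_hasFDerivWithin_le'
      (f' := fderiv ℝ (fderiv ℝ F))
      (fun v hv ↦ (hball v hv).2.1.hasFDerivAt.hasFDerivWithinAt) (fun v hv ↦ ?_) hz' hw
    have a1 := (hball v hv).2.2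
    have a2 := (hball z hz').2.2
    rw [← dist_eq_norm]
    have := dist_triangle_right (fderiv ℝ (fderiv ℝ F) v) B (fderiv ℝ (fderiv ℝ F) p)
    linarith
  -- The Taylor remainder along the segment; it vanishes at `0`, and its derivative is controlled by
  -- `hD`.
  set K : ℝ → ℝ := fun t ↦ F (z + t • h) - (F z + t * fderiv ℝ F z h + t ^ 2 / 2 * B h h) with hK
  have hKd : ∀ t ∈ Set.Icc (0 : ℝ) 1, HasDerivWithinAt K
      (fderiv ℝ F (z + t • h) h - (fderiv ℝ F z h + t * B h h)) (Set.Icc 0 1) t := by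
    intro t ht
    have c1 : HasDerivAt (fun t : ℝ ↦ z + t • h) h t := by
      simpa using ((hasDerivAt_id t).smul_const h).const_add z
    have c2 := (hball _ (hmem t ht)).1.hasFDerivAt.comp_hasDerivAt t c1
    have c3 : HasDerivAt (fun t : ℝ ↦ F z + t * fderiv ℝ F z h + t ^ 2 / 2 * B h h)
        (fderiv ℝ F z h + t * B h h) t := by
      have d1 := ((hasDerivAt_id t).mul_const (fderiv ℝ F z h)).const_add (F z)
      have d2 := (((hasDerivAt_id t).pow 2).div_const 2).mul_const (B h h)
      convert! d1.add d2 using 1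
      simp
    exact (c2.sub c3).hasDerivWithinAt
  have hKb : ∀ t ∈ Set.Ico (0 : ℝ) 1,
      ‖fderiv ℝ F (z + t • h) h - (fderiv ℝ F z h + t * B h h)‖ ≤ ε * ‖h‖ ^ 2 := by
    intro t ht
    have ht' : t ∈ Set.Icc (0 : ℝ) 1 := ⟨ht.1, ht.2.le⟩
    have := hD _ (hmem t ht')
    have e : fderiv ℝ F (z + t • h) h - (fderiv ℝ F z h + t * B h h) =
        (fderiv ℝ F (z + t • h) - fderiv ℝ F z - B (z + t • h - z)) h := by
      simp
      ring
    rw [e]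
    refine (ContinuousLinearMap.le_opNorm _ _).trans ?_
    refine (mul_le_mul_of_nonneg_right this (norm_nonneg _)).trans ?_
    have : ‖z + t • h - z‖ ≤ ‖h‖ := by
      rw [add_sub_cancel_left, norm_smul, Real.norm_of_nonneg ht.1]
      exact mul_le_of_le_one_left (norm_nonneg _) ht.2.le
    rw [pow_two, ← mul_assoc]
    gcongr
  have := norm_image_sub_le_of_norm_deriv_le_segment_01' hKd hKb
  simp only [hK, Real.norm_eq_abs] at this
  convert this using 2
  simp

/-- The second derivative, at a critical point, of a function along a curve. -/
theorem deriv_deriv_comp_of_fderiv_eq_zero {F : W → ℝ} {c : ℝ → W} {t : ℝ}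
    (hF : ContDiffAt ℝ 2 F (c t)) (hc : ContDiffAt ℝ 2 c t) (h0 : fderiv ℝ F (c t) = 0) :
    deriv (deriv (F ∘ c)) t = fderiv ℝ (fderiv ℝ F) (c t) (deriv c t) (deriv c t) := by
  have h1 : ContDiffAt ℝ 1 (fderiv ℝ F) (c t) := hF.fderiv_right (by norm_num)
  have hc1 : ContDiffAt ℝ 1 (deriv c) t := by
    have := hc.fderiv_right (m := 1) (by norm_num)
    exact this.clm_apply contDiffAt_const
  have e : deriv (F ∘ c) =ᶠ[𝓝 t] fun τ ↦ fderiv ℝ F (c τ) (deriv c τ) := by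
    filter_upwards [hc.continuousAt.eventually (hF.eventually (by simp)),
      hc.eventually (by simp)] with τ h1 h2
    exact fderiv_comp_deriv τ (h1.differentiableAt (by simp)) (h2.differentiableAt (by simp))
  rw [e.deriv_eq]
  have d1 : HasDerivAt (fun τ ↦ fderiv ℝ F (c τ)) (fderiv ℝ (fderiv ℝ F) (c t) (deriv c t)) t :=
    (h1.differentiableAt (by simp)).hasFDerivAt.comp_hasDerivAt t
      (hc.differentiableAt (by simp)).hasDerivAt
  have d2 := (hc1.differentiableAt (by simp)).hasDerivAt
  -- The acceleration of the curve is paired with the first derivative of `F`, which is zero.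
  rw [(d1.clm_apply d2).deriv, h0]
  simp

end Calculus

/-! ### Gradients and Hessians in inner product spaces -/

section InnerProduct

variable {V : Type*} [NormedAddCommGroup V] [InnerProductSpace ℝ V] [CompleteSpace V]
  {W : Type*} [NormedAddCommGroup W] [NormedSpace ℝ W]

theorem inner_gradient (G : V → ℝ) (s w : V) : inner ℝ w (gradient G s) = fderiv ℝ G s w := by
  rw [real_inner_comm, gradient, InnerProductSpace.toDual_symm_apply]

theorem inner_fderiv_gradient {G : V → ℝ} {x : V} (hG : ContDiffAt ℝ 2 G x) (v w : V) :
    inner ℝ w (fderiv ℝ (gradient G) x v) = fderiv ℝ (fderiv ℝ G) x v w := by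
  have h1 : ContDiffAt ℝ 1 (fderiv ℝ G) x := hG.fderiv_right (by norm_num)
  have hd : DifferentiableAt ℝ (fderiv ℝ G) x := h1.differentiableAt (by simp)
  let J : StrongDual ℝ V →L[ℝ] V :=
    (InnerProductSpace.toDual ℝ V).symm.toContinuousLinearEquiv.toContinuousLinearMap
  have : HasFDerivAt (gradient G) (J.comp (fderiv ℝ (fderiv ℝ G) x)) x :=
    J.hasFDerivAt.comp x hd.hasFDerivAt
  rw [this.fderiv, real_inner_comm]
  exact InnerProductSpace.toDual_symm_apply

omit [CompleteSpace V] in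
theorem fderiv_comp_affine {F : W → ℝ} {p : W} (L : V →L[ℝ] W) {x : V}
    (hF : DifferentiableAt ℝ F (p + L x)) :
    fderiv ℝ (fun s ↦ F (p + L s)) x = (fderiv ℝ F (p + L x)).comp L :=
  (hF.hasFDerivAt.comp x (L.hasFDerivAt.const_add p)).fderiv

omit [CompleteSpace V] in
theorem fderiv_fderiv_comp_affine {F : W → ℝ} {p : W} (L : V →L[ℝ] W) {x : V}
    (hF : ContDiffAt ℝ 2 F (p + L x)) (v w : V) :
    fderiv ℝ (fderiv ℝ (fun s ↦ F (p + L s))) x v w =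
      fderiv ℝ (fderiv ℝ F) (p + L x) (L v) (L w) := by
  have hL : HasFDerivAt (fun s ↦ p + L s) L x := L.hasFDerivAt.const_add p
  have e : fderiv ℝ (fun s ↦ F (p + L s)) =ᶠ[𝓝 x] fun s ↦ (fderiv ℝ F (p + L s)).comp L := by
    filter_upwards [hL.continuousAt.eventually (hF.eventually (by simp))] with s hs
    exact fderiv_comp_affine L (hs.differentiableAt (by simp))
  have h1 : ContDiffAt ℝ 1 (fderiv ℝ F) (p + L x) := hF.fderiv_right (by norm_num)
  have hd := (h1.differentiableAt (by simp)).hasFDerivAt.comp x hL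
  have hd' : HasFDerivAt (fun s ↦ (fderiv ℝ F (p + L s)).comp L) _ x :=
    hd.clm_comp (hasFDerivAt_const L x)
  rw [e.fderiv_eq, hd'.fderiv]
  simp

theorem isSymmetric_fderiv_gradient {G : V → ℝ} {x : V} (hG : ContDiffAt ℝ 2 G x) :
    ((fderiv ℝ (gradient G) x : V →L[ℝ] V) : V →ₗ[ℝ] V).IsSymmetric := by
  intro v w
  have hs := hG.isSymmSndFDerivAt (by simp)
  rw [real_inner_comm]
  simp only [ContinuousLinearMap.coe_coe, inner_fderiv_gradient hG]
  exact hs v w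

end InnerProduct

/-! ### The least eigenvalue of a symmetric operator -/

section Eigenvalue

variable {V : Type*} [NormedAddCommGroup V] [InnerProductSpace ℝ V] [FiniteDimensional ℝ V]

/-- In finite dimension the infimum of the Rayleigh quotient is itself an eigenvalue, so it
dominates the infimum of the spectrum. -/
theorem sInf_eigenvalue_mul_le {T : V →ₗ[ℝ] V} (hT : T.IsSymmetric) (v : V) :
    sInf {μ : ℝ | Module.End.HasEigenvalue T μ} * ‖v‖ ^ 2 ≤ inner ℝ v (T v) := by
  rcases eq_or_ne v 0 with rfl | hv
  · simp
  have : Nontrivial V := ⟨v, 0, hv⟩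
  have hfin : {μ : ℝ | Module.End.HasEigenvalue T μ}.Finite := Module.End.finite_hasEigenvalue T
  have h1 := csInf_le hfin.bddBelow hT.hasEigenvalue_iInf_of_finiteDimensional
  have hb : BddBelow (Set.range fun x : {x : V // x ≠ 0} ↦
      RCLike.re (inner ℝ (T x) (x : V)) / ‖(x : V)‖ ^ 2) := by
    refine ⟨-‖T.toContinuousLinearMap‖, ?_⟩
    rintro _ ⟨x, rfl⟩
    exact neg_le_of_abs_le (T.toContinuousLinearMap.rayleighQuotient_le_norm (x : V))
  have h2 := ciInf_le hb ⟨v, hv⟩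
  have h3 := h1.trans h2
  simp only [RCLike.re_to_real] at h3
  rw [le_div_iff₀ (by positivity)] at h3
  rwa [real_inner_comm]

/-- The spectrum is finite, so its infimum is attained once it is nonempty; negativity ensures that,
since `sInf ∅ = 0` in `ℝ`. -/
theorem exists_eigenvector_of_sInf_neg {T : V →ₗ[ℝ] V}
    (h : sInf {μ : ℝ | Module.End.HasEigenvalue T μ} < 0) :
    ∃ u : V, ‖u‖ = 1 ∧ T u = sInf {μ : ℝ | Module.End.HasEigenvalue T μ} • u := by
  have hfin : {μ : ℝ | Module.End.HasEigenvalue T μ}.Finite := Module.End.finite_hasEigenvalue T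
  have hne : {μ : ℝ | Module.End.HasEigenvalue T μ}.Nonempty := by
    by_contra hne
    rw [Set.not_nonempty_iff_eq_empty.1 hne, Real.sInf_empty] at h
    exact h.false
  obtain ⟨v, hv⟩ := (hne.csInf_mem hfin).exists_hasEigenvector
  have hv0 : ‖v‖ ≠ 0 := norm_ne_zero_iff.2 hv.2
  refine ⟨‖v‖⁻¹ • v, by simp [norm_smul, hv0], ?_⟩
  rw [map_smul, hv.apply_eq_smul, smul_comm]

end Eigenvalue

/-! ### Compactness of bounded sets in a complete Riemannian manifold -/

section Compactness

/-- Cut a nearly minimizing path where its distance to `x` equals `r`: the first piece has length at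
least `r`, which leaves less than `δ` for the second. -/
theorem exists_intermediate_of_edist_lt (EM : Type*) [NormedAddCommGroup EM] [NormedSpace ℝ EM]
    {M : Type*} [EMetricSpace M] [ChartedSpace EM M] [IsManifold 𝓘(ℝ, EM) ∞ M]
    [Bundle.RiemannianBundle (fun x : M ↦ TangentSpace 𝓘(ℝ, EM) x)]
    [IsRiemannianManifold 𝓘(ℝ, EM) M]
    (x z : M) (r δ : ℝ≥0) (hδ : 0 < δ)
    (h : edist z x < r + δ) : ∃ w, edist w x ≤ r ∧ edist z w < δ := by
  by_cases hr : edist z x ≤ r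
  · exact ⟨z, hr, by simpa using hδ⟩
  rw [edist_comm, IsRiemannianManifold.out (I := 𝓘(ℝ, EM))] at h
  obtain ⟨c, h0, h1, hc, hlen⟩ := Manifold.exists_lt_of_riemannianEDist_lt h
  have hcont : ContinuousOn (fun t ↦ edist (c t) x) (Set.Icc 0 1) :=
    (continuous_id.edist continuous_const).comp_continuousOn hc.continuousOn
  obtain ⟨t, ht, hxt⟩ := intermediate_value_Icc zero_le_one hcont
    (show (r : ENNReal) ∈ _ by simpa [h0, h1] using (not_le.1 hr).le)
  refine ⟨c t, hxt.le, ?_⟩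
  have e1 : (r : ENNReal) ≤ Manifold.pathELength 𝓘(ℝ, EM) c 0 t := by
    rw [← hxt]
    change edist (c t) x ≤ _
    rw [edist_comm, IsRiemannianManifold.out (I := 𝓘(ℝ, EM))]
    exact Manifold.riemannianEDist_le_pathELength
      (hc.mono (Set.Icc_subset_Icc_right ht.2)) h0 rfl ht.1
  have e2 : edist z (c t) ≤ Manifold.pathELength 𝓘(ℝ, EM) c t 1 := by
    rw [edist_comm, IsRiemannianManifold.out (I := 𝓘(ℝ, EM))]
    exact Manifold.riemannianEDist_le_pathELength
      (hc.mono (Set.Icc_subset_Icc_left ht.1)) rfl h1 ht.2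
  rw [← Manifold.pathELength_add ht.1 ht.2] at hlen
  refine e2.trans_lt ?_
  by_contra hcon
  exact absurd hlen (not_lt.2 (add_le_add e1 (not_lt.1 hcon)))

/-- Bounded subsets of a complete Riemannian manifold are relatively compact. -/
theorem IsDistBounded.exists_isCompact_superset (EM : Type*)
    [NormedAddCommGroup EM] [NormedSpace ℝ EM] [FiniteDimensional ℝ EM]
    {M : Type*} [EMetricSpace M] [ChartedSpace EM M] [IsManifold 𝓘(ℝ, EM) ∞ M]
    [Bundle.RiemannianBundle (fun x : M ↦ TangentSpace 𝓘(ℝ, EM) x)]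
    [IsRiemannianManifold 𝓘(ℝ, EM) M]
    [CompleteSpace M] {S : Set M}
    (hS : IsDistBounded S) : ∃ K, IsCompact K ∧ S ⊆ K := by
  have : LocallyCompactSpace M := Manifold.locallyCompact_of_finiteDimensional 𝓘(ℝ, EM)
  obtain ⟨t, r, h⟩ := hS
  refine ⟨⋃ x ∈ t, Metric.closedEBall x r, t.isCompact_biUnion fun x _ ↦
    isCompact_closedEBall_of_intermediate (exists_intermediate_of_edist_lt EM) x r, fun z hz ↦ ?_⟩
  obtain ⟨x, hx, hzx⟩ := h z hz
  exact Set.mem_iUnion₂.2 ⟨x, hx, hzx⟩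

end Compactness

/-! ### Coordinates on the tangent bundle -/

section Coordinates

variable {EM : Type*} [NormedAddCommGroup EM] [NormedSpace ℝ EM]
  {M : Type*} [EMetricSpace M] [ChartedSpace EM M] [IsManifold 𝓘(ℝ, EM) ∞ M]

/-- The coordinate map on the tangent space at `y` given by the trivialization at `z`. -/
def tangentCoord (EM : Type*) [NormedAddCommGroup EM] [NormedSpace ℝ EM]
    {M : Type*} [EMetricSpace M] [ChartedSpace EM M] [IsManifold 𝓘(ℝ, EM) ∞ M] (z y : M) :
    TangentSpace 𝓘(ℝ, EM) y →L[ℝ] EM :=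
  (trivializationAt EM (TangentSpace 𝓘(ℝ, EM) : M → Type _) z).continuousLinearMapAt ℝ y

/-- In the chart of the tangent bundle at `z`, the composition of a `C²` function with a
retraction is `C²` around each tangent space based near `z`. -/
theorem exists_pullback_coordinates {g : M → ℝ} (hg : ContMDiff 𝓘(ℝ, EM) 𝓘(ℝ, ℝ) 2 g)
    {R : TangentBundle 𝓘(ℝ, EM) M → M} (hR : ContMDiff (𝓘(ℝ, EM)).tangent 𝓘(ℝ, EM) ∞ R) (z : M) :
    ∃ F : EM × EM → ℝ,
      (∀ y ∈ (chartAt EM z).source, ∀ v : EM, ContDiffAt ℝ 2 F (extChartAt 𝓘(ℝ, EM) z y, v)) ∧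
      ∀ y ∈ (chartAt EM z).source, ∀ s : TangentSpace 𝓘(ℝ, EM) y,
        g (R ⟨y, s⟩) = F (extChartAt 𝓘(ℝ, EM) z y, tangentCoord EM z y s) := by
  set e := extChartAt (𝓘(ℝ, EM)).tangent (⟨z, 0⟩ : TangentBundle 𝓘(ℝ, EM) M) with he
  have hsrc : ∀ y ∈ (chartAt EM z).source, ∀ s : TangentSpace 𝓘(ℝ, EM) y,
      (⟨y, s⟩ : TangentBundle 𝓘(ℝ, EM) M) ∈ e.source := by
    intro y hy s
    rw [he, extChartAt_source]
    exact (TangentBundle.mem_chart_source_iff _ _).2 hy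
  have hmap : ∀ y ∈ (chartAt EM z).source, ∀ s : TangentSpace 𝓘(ℝ, EM) y,
      e ⟨y, s⟩ = (extChartAt 𝓘(ℝ, EM) z y, tangentCoord EM z y s) := by
    intro y hy s
    rw [he, FiberBundle.extChartAt, tangentCoord, Bundle.Trivialization.continuousLinearMapAt_apply,
      Bundle.Trivialization.coe_linearMapAt_of_mem _ hy]
    rfl
  have hF : ContDiffOn ℝ 2 (g ∘ R ∘ e.symm) e.target := by
    rw [← contMDiffOn_iff_contDiffOn]
    have h1 : ContMDiffOn 𝓘(ℝ, EM × EM) (𝓘(ℝ, EM)).tangent 2 e.symm e.target :=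
      (contMDiffOn_extChartAt_symm (n := ∞) _).of_le ENat.LEInfty.out
    exact hg.comp_contMDiffOn ((hR.of_le ENat.LEInfty.out).comp_contMDiffOn h1)
  refine ⟨g ∘ R ∘ e.symm, fun y hy v ↦ ?_, fun y hy s ↦ ?_⟩
  · refine hF.contDiffAt ((isOpen_extChartAt_target _).mem_nhds ?_)
    -- The bundle chart covers whole fibres, so every `v` is the coordinate of a tangent vector and
    -- `(y, v)` lies in the chart target.
    obtain ⟨s, rfl⟩ : ∃ s, tangentCoord EM z y s = v :=
      ⟨_, Bundle.Trivialization.continuousLinearMapAt_symmL _ hy v⟩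
    rw [← hmap y hy s]
    exact e.map_source (hsrc y hy s)
  · rw [← hmap y hy s]
    simp only [Function.comp_apply]
    rw [e.left_inv (hsrc y hy s)]

theorem contMDiff_fiberLine (y : M) (u : TangentSpace 𝓘(ℝ, EM) y) :
    ContMDiff 𝓘(ℝ, ℝ) (𝓘(ℝ, EM)).tangent ∞
      (fun t : ℝ ↦ (⟨y, t • u⟩ : TangentBundle 𝓘(ℝ, EM) M)) := by
  intro t
  rw [Bundle.contMDiffAt_totalSpace]
  refine ⟨contMDiffAt_const, ?_⟩
  have hy : y ∈ (trivializationAt EM (TangentSpace 𝓘(ℝ, EM) : M → Type _) y).baseSet :=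
    FiberBundle.mem_baseSet_trivializationAt' y
  have : (fun t : ℝ ↦ (trivializationAt EM (TangentSpace 𝓘(ℝ, EM) : M → Type _) y
      ⟨y, t • u⟩).2) = fun t : ℝ ↦ t • tangentCoord EM y y u := by
    ext1 t
    rw [← map_smul, tangentCoord, Bundle.Trivialization.continuousLinearMapAt_apply,
      Bundle.Trivialization.coe_linearMapAt_of_mem _ hy]
  simp only
  rw [this]
  exact (contDiff_id.smul contDiff_const).contMDiff t

end Coordinates

/-! ### Derivatives of the pullback at the origin -/

section Pullback

variable {EM : Type*} [NormedAddCommGroup EM] [NormedSpace ℝ EM] [FiniteDimensional ℝ EM]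
  {M : Type*} [EMetricSpace M] [ChartedSpace EM M]
  [IsManifold 𝓘(ℝ, EM) ∞ M] [Bundle.RiemannianBundle (fun x : M ↦ TangentSpace 𝓘(ℝ, EM) x)]
  {g : M → ℝ} {R : TangentBundle 𝓘(ℝ, EM) M → M}

/-- The tangent vector at `y` as a vertical vector in the chart of the tangent bundle at `z`. -/
def verticalCoord (EM : Type*) [NormedAddCommGroup EM] [NormedSpace ℝ EM]
    {M : Type*} [EMetricSpace M] [ChartedSpace EM M] [IsManifold 𝓘(ℝ, EM) ∞ M] (z y : M) :
    TangentSpace 𝓘(ℝ, EM) y →L[ℝ] EM × EM :=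
  (ContinuousLinearMap.inr ℝ EM EM).comp (tangentCoord EM z y)

omit [FiniteDimensional ℝ EM]
  [Bundle.RiemannianBundle (fun x : M ↦ TangentSpace 𝓘(ℝ, EM) x)] in
theorem pullback_eq_comp_verticalCoord {F : EM × EM → ℝ} {z y : M}
    (hF : ∀ s : TangentSpace 𝓘(ℝ, EM) y,
      g (R ⟨y, s⟩) = F (extChartAt 𝓘(ℝ, EM) z y, tangentCoord EM z y s)) :
    pullback g R y = fun s ↦ F ((extChartAt 𝓘(ℝ, EM) z y, 0) + verticalCoord EM z y s) := by
  ext s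
  rw [pullback, hF s]
  simp [verticalCoord]

theorem contDiffAt_pullback (hg : ContMDiff 𝓘(ℝ, EM) 𝓘(ℝ, ℝ) 2 g) (hR : IsRetraction R) (y : M) :
    ContDiffAt ℝ 2 (pullback g R y) 0 := by
  obtain ⟨F, hF, hgF⟩ := exists_pullback_coordinates hg hR.smooth y
  have hy : y ∈ (chartAt EM y).source := mem_chart_source EM y
  rw [pullback_eq_comp_verticalCoord (hgF y hy)]
  have h1 : ContDiffAt ℝ 2 (fun s : TangentSpace 𝓘(ℝ, EM) y ↦
      ((extChartAt 𝓘(ℝ, EM) y y, 0) : EM × EM) + verticalCoord EM y y s) 0 :=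
    contDiffAt_const.add (verticalCoord EM y y).contDiff.contDiffAt
  refine ContDiffAt.comp (g := F) 0 ?_ h1
  simpa using hF y hy 0

theorem inner_pullbackHessian (hg : ContMDiff 𝓘(ℝ, EM) 𝓘(ℝ, ℝ) 2 g) (hR : IsRetraction R) (y : M)
    (v w : TangentSpace 𝓘(ℝ, EM) y) :
    inner ℝ w (pullbackHessian g R y v) = fderiv ℝ (fderiv ℝ (pullback g R y)) 0 v w :=
  inner_fderiv_gradient (contDiffAt_pullback hg hR y) v w

theorem isSymmetric_pullbackHessian (hg : ContMDiff 𝓘(ℝ, EM) 𝓘(ℝ, ℝ) 2 g) (hR : IsRetraction R)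
    (y : M) : ((pullbackHessian g R y : TangentSpace 𝓘(ℝ, EM) y →L[ℝ] TangentSpace 𝓘(ℝ, EM) y) :
      TangentSpace 𝓘(ℝ, EM) y →ₗ[ℝ] TangentSpace 𝓘(ℝ, EM) y).IsSymmetric :=
  isSymmetric_fderiv_gradient (contDiffAt_pullback hg hR y)

theorem leastEigenvalue_mul_le (hg : ContMDiff 𝓘(ℝ, EM) 𝓘(ℝ, ℝ) 2 g) (hR : IsRetraction R)
    (y : M) (v : TangentSpace 𝓘(ℝ, EM) y) :
    leastEigenvalue g R y * ‖v‖ ^ 2 ≤ inner ℝ v (pullbackHessian g R y v) :=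
  sInf_eigenvalue_mul_le (isSymmetric_pullbackHessian hg hR y) v

theorem IsRetraction.apply_zero (hR : IsRetraction R) (y : M) : R ⟨y, 0⟩ = y := by
  have := congrArg Bundle.TotalSpace.proj (hR.tangent y 0)
  simpa [tangentMap] using this

theorem IsRetraction.contMDiff_line (hR : IsRetraction R) (y : M) (u : TangentSpace 𝓘(ℝ, EM) y) :
    ContMDiff 𝓘(ℝ, ℝ) 𝓘(ℝ, EM) ∞ (fun t : ℝ ↦ R ⟨y, t • u⟩) :=
  hR.smooth.comp (contMDiff_fiberLine y u)

-- The chain rule, with the velocity given as an equality in the tangent bundle, so that no vector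
-- has to be transported along `c 0 = y`.
omit [FiniteDimensional ℝ EM] [IsManifold 𝓘(ℝ, EM) ∞ M]
  [Bundle.RiemannianBundle (fun x : M ↦ TangentSpace 𝓘(ℝ, EM) x)] in
theorem deriv_comp_curve {F : Type*} [NormedAddCommGroup F] [NormedSpace ℝ F] {h : M → F}
    {c : ℝ → M} {y : M} {u : TangentSpace 𝓘(ℝ, EM) y}
    (hc : tangentMap 𝓘(ℝ, ℝ) 𝓘(ℝ, EM) c ⟨0, (1 : ℝ)⟩ = ⟨y, u⟩)
    (hcd : MDifferentiableAt 𝓘(ℝ, ℝ) 𝓘(ℝ, EM) c 0)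
    (hh : MDifferentiableAt 𝓘(ℝ, EM) 𝓘(ℝ, F) h y) :
    deriv (h ∘ c) 0 = (mfderiv 𝓘(ℝ, EM) 𝓘(ℝ, F) h y u : F) := by
  have hy : c 0 = y := congrArg Bundle.TotalSpace.proj hc
  have h1 := tangentMap_comp_at (I := 𝓘(ℝ, ℝ)) (I' := 𝓘(ℝ, EM)) (I'' := 𝓘(ℝ, F)) (f := c) (g := h)
    ⟨0, (1 : ℝ)⟩ (by simpa [hy] using hh) hcd
  rw [hc] at h1
  have h2 : (mfderiv 𝓘(ℝ, ℝ) 𝓘(ℝ, F) (h ∘ c) 0 (1 : ℝ) : F) =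
      (mfderiv 𝓘(ℝ, EM) 𝓘(ℝ, F) h y u : F) :=
    congrArg (fun p : TangentBundle 𝓘(ℝ, F) F ↦ (p.2 : F)) h1
  rw [← h2, mfderiv_eq_fderiv]
  rfl

/-- A retraction is tangent to the identity: the curve `R ⟨y, t • u⟩` has initial velocity `u`. -/
theorem fderiv_pullback (hg : ContMDiff 𝓘(ℝ, EM) 𝓘(ℝ, ℝ) 2 g) (hR : IsRetraction R) (y : M) :
    fderiv ℝ (pullback g R y) 0 =
      (mfderiv 𝓘(ℝ, EM) 𝓘(ℝ, ℝ) g y : TangentSpace 𝓘(ℝ, EM) y →L[ℝ] ℝ) := by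
  ext u
  have h1 := deriv_comp_curve (hR.tangent y u)
    ((hR.contMDiff_line y u 0).mdifferentiableAt (by simp)) (hg.mdifferentiableAt (by simp))
  refine Eq.trans ?_ h1
  have h2 : HasDerivAt (fun t : ℝ ↦ t • u) u 0 := by
    simpa using (hasDerivAt_id (0 : ℝ)).smul_const u
  have h3 : HasFDerivAt (pullback g R y) (fderiv ℝ (pullback g R y) 0) ((0 : ℝ) • u) := by
    rw [zero_smul]
    exact ((contDiffAt_pullback hg hR y).differentiableAt (by simp)).hasFDerivAt
  exact (h3.comp_hasDerivAt 0 h2).deriv.symm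

theorem gradient_pullback (hg : ContMDiff 𝓘(ℝ, EM) 𝓘(ℝ, ℝ) 2 g) (hR : IsRetraction R) (y : M) :
    gradient (pullback g R y) 0 = riemannianGradient EM g y := by
  rw [gradient, fderiv_pullback hg hR, riemannianGradient]

theorem model_eq (hg : ContMDiff 𝓘(ℝ, EM) 𝓘(ℝ, ℝ) 2 g) (hR : IsRetraction R) (y : M)
    (s : TangentSpace 𝓘(ℝ, EM) y) :
    model g R y s = g y + inner ℝ s (riemannianGradient EM g y) +
      1 / 2 * inner ℝ s (pullbackHessian g R y s) := by
  rw [model, gradient_pullback hg hR]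

theorem model_zero (y : M) : model g R y 0 = g y := by
  simp [model]

/-! ### From pullback derivatives to 2-criticality -/

section Criticality

omit [FiniteDimensional ℝ EM]
  [Bundle.RiemannianBundle (fun x : M ↦ TangentSpace 𝓘(ℝ, EM) x)] in
/-- At a critical point, the second derivative of a function along a curve depends only on the
velocity of the curve. -/
theorem deriv_deriv_comp_eq_of_tangentMap_eq (hg : ContMDiff 𝓘(ℝ, EM) 𝓘(ℝ, ℝ) 2 g) {y : M}
    {u : TangentSpace 𝓘(ℝ, EM) y} (h0 : mfderiv 𝓘(ℝ, EM) 𝓘(ℝ, ℝ) g y = 0) {c₁ c₂ : ℝ → M}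
    (hc₁ : ContMDiff 𝓘(ℝ, ℝ) 𝓘(ℝ, EM) ∞ c₁) (hc₂ : ContMDiff 𝓘(ℝ, ℝ) 𝓘(ℝ, EM) ∞ c₂)
    (ht₁ : tangentMap 𝓘(ℝ, ℝ) 𝓘(ℝ, EM) c₁ ⟨0, (1 : ℝ)⟩ = ⟨y, u⟩)
    (ht₂ : tangentMap 𝓘(ℝ, ℝ) 𝓘(ℝ, EM) c₂ ⟨0, (1 : ℝ)⟩ = ⟨y, u⟩) :
    deriv (deriv (g ∘ c₁)) 0 = deriv (deriv (g ∘ c₂)) 0 := by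
  set χ := extChartAt 𝓘(ℝ, EM) y with hχ
  set G : EM → ℝ := g ∘ χ.symm with hG
  have hsymm : ContMDiffAt 𝓘(ℝ, EM) 𝓘(ℝ, EM) 2 χ.symm (χ y) :=
    ((contMDiffOn_extChartAt_symm (n := ∞) y).of_le ENat.LEInfty.out).contMDiffAt
      (extChartAt_target_mem_nhds y)
  have hG2 : ContDiffAt ℝ 2 G (χ y) :=
    (ContMDiffAt.comp (χ y) (hg _) hsymm).contDiffAt
  have hG0 : fderiv ℝ G (χ y) = 0 := by
    rw [← mfderiv_eq_fderiv, hG]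
    have e : χ.symm (χ y) = y := extChartAt_to_inv y
    rw [mfderiv_comp (I' := 𝓘(ℝ, EM)) _ (hg.mdifferentiableAt (by simp))
      (hsymm.mdifferentiableAt (by simp)), e, h0]
    rfl
  -- Read in the chart at `y`, where `G` has a critical point, the second derivative along `c` sees
  -- only the coordinate velocity, which `u` determines.
  have key : ∀ c : ℝ → M, ContMDiff 𝓘(ℝ, ℝ) 𝓘(ℝ, EM) ∞ c →
      tangentMap 𝓘(ℝ, ℝ) 𝓘(ℝ, EM) c ⟨0, (1 : ℝ)⟩ = ⟨y, u⟩ →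
      deriv (deriv (g ∘ c)) 0 = fderiv ℝ (fderiv ℝ G) (χ y)
        (mfderiv 𝓘(ℝ, EM) 𝓘(ℝ, EM) χ y u : EM) (mfderiv 𝓘(ℝ, EM) 𝓘(ℝ, EM) χ y u : EM) := by
    intro c hc ht
    have hy : c 0 = y := congrArg Bundle.TotalSpace.proj ht
    have hχy : ContMDiffAt 𝓘(ℝ, EM) 𝓘(ℝ, EM) 2 χ y := contMDiffAt_extChartAt
    rw [← deriv_comp_curve ht ((hc 0).mdifferentiableAt (by simp))
      (hχy.mdifferentiableAt (by simp))]
    have hc2 : ContDiffAt ℝ 2 (χ ∘ c) 0 :=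
      (ContMDiffAt.comp 0 (by rw [hy]; exact hχy) ((hc 0).of_le ENat.LEInfty.out)).contDiffAt
    have e0 : (χ ∘ c) 0 = χ y := by simp [hy]
    have e : g ∘ c =ᶠ[𝓝 0] G ∘ (χ ∘ c) := by
      have : ∀ᶠ t in 𝓝 0, c t ∈ χ.source :=
        hc.continuous.continuousAt (by rw [hy]; exact extChartAt_source_mem_nhds y)
      filter_upwards [this] with t h
      simp [hG, χ.left_inv h]
    rw [e.deriv.deriv_eq, deriv_deriv_comp_of_fderiv_eq_zero (by rwa [e0]) hc2 (by rwa [e0]), e0]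
  rw [key c₁ hc₁ ht₁, key c₂ hc₂ ht₂]

/-- Vanishing gradient and positive semidefinite Hessian of the pullback imply 2-criticality. -/
theorem isTwoCritical_of_nonneg (hg : ContMDiff 𝓘(ℝ, EM) 𝓘(ℝ, ℝ) 2 g) (hR : IsRetraction R) {y : M}
    (h1 : riemannianGradient EM g y = 0)
    (h2 : ∀ u : TangentSpace 𝓘(ℝ, EM) y, 0 ≤ inner ℝ u (pullbackHessian g R y u)) :
    IsTwoCritical EM g y := by
  rintro c hc rfl
  have hf : fderiv ℝ (pullback g R (c 0)) 0 = 0 := by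
    ext w
    rw [← inner_gradient, gradient_pullback hg hR, h1]
    simp
  have h0 : mfderiv 𝓘(ℝ, EM) 𝓘(ℝ, ℝ) g (c 0) = 0 := (fderiv_pullback hg hR (c 0)).symm.trans hf
  have ht : tangentMap 𝓘(ℝ, ℝ) 𝓘(ℝ, EM) c ⟨0, (1 : ℝ)⟩ =
    ⟨c 0, mfderiv 𝓘(ℝ, ℝ) 𝓘(ℝ, EM) c 0 (1 : ℝ)⟩ := rfl
  set u : TangentSpace 𝓘(ℝ, EM) (c 0) := mfderiv 𝓘(ℝ, ℝ) 𝓘(ℝ, EM) c 0 (1 : ℝ) with hu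
  refine ⟨?_, ?_⟩
  · rw [deriv_comp_curve ht ((hc 0).mdifferentiableAt (by simp)) (hg.mdifferentiableAt (by simp)),
      h0]
    rfl
  -- The arbitrary curve is replaced by the retraction curve of the same velocity, along which `g`
  -- is the pullback restricted to a line.
  · rw [deriv_deriv_comp_eq_of_tangentMap_eq hg h0 hc (hR.contMDiff_line _ u) ht (hR.tangent _ u)]
    have e : (g ∘ fun t : ℝ ↦ R ⟨c 0, t • u⟩) = pullback g R (c 0) ∘ fun t : ℝ ↦ t • u := rfl
    have hz : (0 : ℝ) • u = 0 := zero_smul _ _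
    have hd : deriv (fun t : ℝ ↦ t • u) 0 = u := by
      simpa using ((hasDerivAt_id (0 : ℝ)).smul_const u).deriv
    have hp := contDiffAt_pullback hg hR (c 0)
    have hl : ContDiffAt ℝ 2 (fun t : ℝ ↦ t • u) 0 := contDiffAt_id.smul contDiffAt_const
    rw [e, deriv_deriv_comp_of_fderiv_eq_zero (by simpa only [hz] using hp) hl
      (by simpa only [hz] using hf), hd, hz, ← inner_pullbackHessian hg hR]
    exact h2 u

end Criticality

end Pullback

/-! ### Locally uniform estimates -/

section LocalEstimates

set_option synthInstance.maxHeartbeats 200000 in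
theorem exists_eventually_norm_fderiv_le {W : Type*} [NormedAddCommGroup W] [NormedSpace ℝ W]
    {F : W → ℝ} {p : W} (hF : ContDiffAt ℝ 2 F p) :
    ∃ B > 0, ∀ᶠ w in 𝓝 p, (∀ v, fderiv ℝ F w v ≤ B * ‖v‖) ∧
      ∀ v, |fderiv ℝ (fderiv ℝ F) w v v| ≤ B * ‖v‖ ^ 2 := by
  have h1 : ContDiffAt ℝ 1 (fderiv ℝ F) p := hF.fderiv_right (by norm_num)
  have h2 : ContinuousAt (fderiv ℝ (fderiv ℝ F)) p :=
    (h1.fderiv_right (m := 0) (by norm_num)).continuousAt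
  have h3 : ∀ᶠ w in 𝓝 p, ‖fderiv ℝ (fderiv ℝ F) w‖ < ‖fderiv ℝ (fderiv ℝ F) p‖ + 1 :=
    (ContinuousAt.norm (E := W →L[ℝ] W →L[ℝ] ℝ) h2).eventually_lt continuousAt_const (lt_add_one _)
  refine ⟨‖fderiv ℝ F p‖ + ‖fderiv ℝ (fderiv ℝ F) p‖ + 1, by positivity, ?_⟩
  filter_upwards [h1.continuousAt.norm.eventually_lt continuousAt_const (lt_add_one _), h3]
    with w e1 e2
  refine ⟨fun v ↦ ?_, fun v ↦ ?_⟩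
  · refine (Real.le_norm_self _).trans ((ContinuousLinearMap.le_opNorm _ _).trans ?_)
    gcongr
    linarith [norm_nonneg (fderiv ℝ (fderiv ℝ F) p)]
  · rw [← Real.norm_eq_abs]
    refine (ContinuousLinearMap.le_opNorm₂ _ _ _).trans ?_
    rw [mul_assoc, ← pow_two]
    gcongr
    linarith [norm_nonneg (fderiv ℝ F p)]

variable {EM : Type*} [NormedAddCommGroup EM] [NormedSpace ℝ EM] [FiniteDimensional ℝ EM]
  {M : Type*} [EMetricSpace M] [ChartedSpace EM M]
  [IsManifold 𝓘(ℝ, EM) ∞ M] [Bundle.RiemannianBundle (fun x : M ↦ TangentSpace 𝓘(ℝ, EM) x)]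
  [IsContMDiffRiemannianBundle 𝓘(ℝ, EM) ∞ EM (fun x : M ↦ TangentSpace 𝓘(ℝ, EM) x)]
  {g : M → ℝ} {R : TangentBundle 𝓘(ℝ, EM) M → M}

omit [FiniteDimensional ℝ EM] in
theorem isContinuousRiemannianBundle_tangentSpace :
    IsContinuousRiemannianBundle EM (fun x : M ↦ TangentSpace 𝓘(ℝ, EM) x) := by
  obtain ⟨m, hm, h⟩ := IsContMDiffRiemannianBundle.exists_contMDiff (IB := 𝓘(ℝ, EM)) (n := ∞)
    (F := EM) (E := fun x : M ↦ TangentSpace 𝓘(ℝ, EM) x)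
  exact ⟨m, hm.continuous, h⟩

/-- Near any point, the pullbacks, with their first and second derivatives at the origin, are read
off a single `C²` function on a vector space, up to uniformly bounded changes of coordinates. -/
theorem exists_local_model (hg : ContMDiff 𝓘(ℝ, EM) 𝓘(ℝ, ℝ) 2 g) (hR : IsRetraction R) (z : M) :
    ∃ (F : EM × EM → ℝ) (p : M → EM × EM)
      (L : ∀ y : M, TangentSpace 𝓘(ℝ, EM) y →L[ℝ] EM × EM) (K : ℝ), 0 < K ∧
      ContDiffAt ℝ 2 F (p z) ∧ ContinuousAt p z ∧
      ∀ᶠ y in 𝓝 z,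
        (∀ s, g (R ⟨y, s⟩) = F (p y + L y s)) ∧
        (∀ s, inner ℝ s (riemannianGradient EM g y) = fderiv ℝ F (p y) (L y s)) ∧
        (∀ s, inner ℝ s (pullbackHessian g R y s) =
          fderiv ℝ (fderiv ℝ F) (p y) (L y s) (L y s)) ∧
        (∀ s, ‖L y s‖ ≤ K * ‖s‖) ∧
        ∀ u : TangentSpace 𝓘(ℝ, EM) z, ∃ s, L y s = L z u ∧ ‖s‖ ≤ K * ‖L z u‖ := by
  have := isContinuousRiemannianBundle_tangentSpace (EM := EM) (M := M)
  obtain ⟨F, hF, hgF⟩ := exists_pullback_coordinates hg hR.smooth z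
  obtain ⟨C₁, hC₁, h₁⟩ := eventually_norm_trivializationAt_lt EM
    (fun x : M ↦ TangentSpace 𝓘(ℝ, EM) x) z
  obtain ⟨C₂, hC₂, h₂⟩ := eventually_norm_symmL_trivializationAt_lt EM
    (fun x : M ↦ TangentSpace 𝓘(ℝ, EM) x) z
  refine ⟨F, fun y ↦ (extChartAt 𝓘(ℝ, EM) z y, 0), verticalCoord EM z, C₁ + C₂, by positivity,
    hF z (mem_chart_source EM z) 0, (continuousAt_extChartAt z).prodMk continuousAt_const, ?_⟩
  filter_upwards [h₁, h₂, chart_source_mem_nhds EM z] with y h₁ h₂ hy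
  have hpb := pullback_eq_comp_verticalCoord (hgF y hy)
  have hFy : ContDiffAt ℝ 2 F ((extChartAt 𝓘(ℝ, EM) z y, 0) + verticalCoord EM z y 0) := by
    simpa using hF y hy 0
  refine ⟨fun s ↦ congrFun hpb s, fun s ↦ ?_, fun s ↦ ?_, fun s ↦ ?_, fun u ↦ ?_⟩
  · rw [← gradient_pullback hg hR, inner_gradient, hpb,
      fderiv_comp_affine _ (hFy.differentiableAt (by simp))]
    simp
  · rw [inner_pullbackHessian hg hR, hpb, fderiv_fderiv_comp_affine _ hFy]
    simp
  · have : ‖verticalCoord EM z y s‖ = ‖tangentCoord EM z y s‖ := by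
      simp [verticalCoord, Prod.norm_def]
    rw [this]
    refine ((tangentCoord EM z y).le_opNorm s).trans ?_
    gcongr
    exact h₁.le.trans (by linarith)
  -- The vector over `y` with the same coordinates as `u`; it serves to carry test vectors from `z`
  -- to nearby tangent spaces.
  · refine ⟨(trivializationAt EM (TangentSpace 𝓘(ℝ, EM) : M → Type _) z).symmL ℝ y
      (tangentCoord EM z z u), ?_, ?_⟩
    · have : tangentCoord EM z y ((trivializationAt EM (TangentSpace 𝓘(ℝ, EM) : M → Type _)
          z).symmL ℝ y (tangentCoord EM z z u)) = tangentCoord EM z z u :=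
        Bundle.Trivialization.continuousLinearMapAt_symmL _ hy _
      simp [verticalCoord, this]
    · have : ‖verticalCoord EM z z u‖ = ‖tangentCoord EM z z u‖ := by
        simp [verticalCoord, Prod.norm_def]
      rw [this]
      refine (ContinuousLinearMap.le_opNorm _ _).trans ?_
      gcongr
      exact h₂.le.trans (by linarith)

/-- The quadratic models approximate the pullbacks to second order, locally uniformly. -/
theorem exists_eventually_abs_sub_model_le (hg : ContMDiff 𝓘(ℝ, EM) 𝓘(ℝ, ℝ) 2 g)
    (hR : IsRetraction R) (z : M) {ε : ℝ} (hε : 0 < ε) :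
    ∃ r > 0, ∀ᶠ y in 𝓝 z, ∀ s : TangentSpace 𝓘(ℝ, EM) y, ‖s‖ < r →
      |g (R ⟨y, s⟩) - model g R y s| ≤ ε * ‖s‖ ^ 2 := by
  obtain ⟨F, p, L, K, hK, hF, hp, h⟩ := exists_local_model hg hR z
  -- The factor `K ^ 2` pays for passing from the coordinate norm to the Riemannian norm.
  obtain ⟨r, hr, hT⟩ := exists_taylor_two_uniform hF (ε := ε / K ^ 2) (by positivity)
  refine ⟨r / K, by positivity, ?_⟩
  filter_upwards [h, hp.eventually (Metric.ball_mem_nhds (p z) hr)]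
    with y ⟨h1, h2, h3, h4, _⟩ hy s hs
  have hLs : L y s ∈ Metric.ball (0 : EM × EM) r := by
    rw [mem_ball_zero_iff]
    refine (h4 s).trans_lt ?_
    rwa [lt_div_iff₀' hK] at hs
  have hgy : g y = F (p y) := by
    have := h1 0
    rwa [hR.apply_zero, map_zero, add_zero] at this
  rw [model_eq hg hR, h1, h2, h3, hgy]
  refine (hT (p y) hy (L y s) hLs).trans ?_
  calc ε / K ^ 2 * ‖L y s‖ ^ 2 ≤ ε / K ^ 2 * (K * ‖s‖) ^ 2 := by
        gcongr
        exact h4 s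
    _ = ε * ‖s‖ ^ 2 := by
        field_simp

theorem exists_eventually_norm_le (hg : ContMDiff 𝓘(ℝ, EM) 𝓘(ℝ, ℝ) 2 g)
    (hR : IsRetraction R) (z : M) :
    ∃ C > 0, ∀ᶠ y in 𝓝 z, ‖riemannianGradient EM g y‖ ≤ C ∧
      ∀ s : TangentSpace 𝓘(ℝ, EM) y, |inner ℝ s (pullbackHessian g R y s)| ≤ C * ‖s‖ ^ 2 := by
  obtain ⟨F, p, L, K, hK, hF, hp, h⟩ := exists_local_model hg hR z
  obtain ⟨B, hB, hFB⟩ := exists_eventually_norm_fderiv_le hF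
  refine ⟨B * K + B * K ^ 2, by positivity, ?_⟩
  have k2 : 0 < B * K ^ 2 := by positivity
  have k3 : 0 < B * K := by positivity
  filter_upwards [h, hp.eventually hFB] with y ⟨_, h2, h3, h4, _⟩ ⟨e1, e2⟩
  refine ⟨?_, fun s ↦ ?_⟩
  · set G := riemannianGradient EM g y with hG
    have k1 : ‖G‖ * ‖G‖ ≤ B * K * ‖G‖ := by
      rw [← real_inner_self_eq_norm_mul_norm, h2 G, mul_assoc]
      exact (e1 _).trans (mul_le_mul_of_nonneg_left (h4 G) hB.le)
    rcases (norm_nonneg G).eq_or_lt with h0 | h0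
    · rw [← h0]
      positivity
    · linarith [le_of_mul_le_mul_right k1 h0]
  · rw [h3 s]
    calc _ ≤ B * ‖L y s‖ ^ 2 := e2 _
      _ ≤ B * (K * ‖s‖) ^ 2 := by
          gcongr
          exact h4 s
      _ = B * K ^ 2 * ‖s‖ ^ 2 := by ring
      _ ≤ _ := by
          gcongr
          linarith

/-- The gradient at `z`, carried to nearby tangent spaces, keeps bounded norm, and the derivative of
`g` along it stays away from zero; Cauchy–Schwarz then bounds the gradient below. -/
theorem exists_eventually_le_norm_gradient (hg : ContMDiff 𝓘(ℝ, EM) 𝓘(ℝ, ℝ) 2 g)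
    (hR : IsRetraction R) {z : M} (hz : riemannianGradient EM g z ≠ 0) :
    ∃ c > 0, ∀ᶠ y in 𝓝 z, c ≤ ‖riemannianGradient EM g y‖ := by
  obtain ⟨F, p, L, K, hK, hF, hp, h⟩ := exists_local_model hg hR z
  have hF1 : ContDiffAt ℝ 1 (fderiv ℝ F) (p z) := hF.fderiv_right (by norm_num)
  set u := riemannianGradient EM g z with hu
  obtain ⟨-, h2, -⟩ := h.self_of_nhds
  have hpos : 0 < fderiv ℝ F (p z) (L z u) := by
    rw [← h2 u, ← hu, real_inner_self_eq_norm_sq]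
    have := norm_pos_iff.2 hz
    positivity
  set q := fderiv ℝ F (p z) (L z u) with hq
  have e : ∀ᶠ y in 𝓝 z, q / 2 < fderiv ℝ F (p y) (L z u) :=
    continuousAt_const.eventually_lt
      ((ContinuousAt.comp (g := fderiv ℝ F) (f := p) hF1.continuousAt hp).clm_apply
        continuousAt_const) (half_lt_self hpos)
  refine ⟨q / 2 / (K * ‖L z u‖ + 1), by positivity, ?_⟩
  filter_upwards [h, e] with y ⟨_, h2, _, _, h5⟩ e
  obtain ⟨s, hs, hsn⟩ := h5 u
  rw [div_le_iff₀ (by positivity)]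
  rw [← hs, ← h2 s] at e
  calc q / 2 ≤ inner ℝ s (riemannianGradient EM g y) := e.le
    _ ≤ ‖s‖ * ‖riemannianGradient EM g y‖ := real_inner_le_norm _ _
    _ ≤ (K * ‖L z u‖ + 1) * ‖riemannianGradient EM g y‖ := by
        gcongr
        linarith
    _ = _ := mul_comm _ _

/-- The direction `u`, carried to nearby tangent spaces, is a Rayleigh test vector of bounded norm;
this one-sided bound avoids any continuity of eigenvalues. -/
theorem exists_eventually_leastEigenvalue_le (hg : ContMDiff 𝓘(ℝ, EM) 𝓘(ℝ, ℝ) 2 g)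
    (hR : IsRetraction R) {z : M} {u : TangentSpace 𝓘(ℝ, EM) z}
    (hz : inner ℝ u (pullbackHessian g R z u) < 0) :
    ∃ c > 0, ∀ᶠ y in 𝓝 z, leastEigenvalue g R y ≤ -c := by
  obtain ⟨F, p, L, K, hK, hF, hp, h⟩ := exists_local_model hg hR z
  have hF1 : ContDiffAt ℝ 1 (fderiv ℝ F) (p z) := hF.fderiv_right (by norm_num)
  have hF2 : ContinuousAt (fderiv ℝ (fderiv ℝ F)) (p z) :=
    (hF1.fderiv_right (m := 0) (by norm_num)).continuousAt
  obtain ⟨-, -, h3, -⟩ := h.self_of_nhds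
  rw [h3 u] at hz
  set q := fderiv ℝ (fderiv ℝ F) (p z) (L z u) (L z u) with hq
  have e : ∀ᶠ y in 𝓝 z, fderiv ℝ (fderiv ℝ F) (p y) (L z u) (L z u) < q / 2 :=
    (((ContinuousAt.comp (g := fderiv ℝ (fderiv ℝ F)) (f := p) hF2 hp).clm_apply
      continuousAt_const).clm_apply continuousAt_const).eventually_lt continuousAt_const
      (show q < q / 2 by linarith)
  refine ⟨-(q / 2) / (K * ‖L z u‖ + 1) ^ 2, div_pos (by linarith) (by positivity), ?_⟩
  filter_upwards [h, e] with y ⟨_, _, h3, _, h5⟩ e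
  obtain ⟨s, hs, hsn⟩ := h5 u
  rw [← hs, ← h3 s] at e
  have k := leastEigenvalue_mul_le hg hR y s
  have hs2 : ‖s‖ ^ 2 ≤ (K * ‖L z u‖ + 1) ^ 2 := by
    gcongr
    linarith
  have hneg : leastEigenvalue g R y < 0 := by
    by_contra hcon
    have := mul_nonneg (not_lt.1 hcon) (sq_nonneg ‖s‖)
    linarith
  have := mul_le_mul_of_nonpos_left hs2 hneg.le
  rw [le_neg, div_le_iff₀ (by positivity)]
  linarith

end LocalEstimates

/-! ### Analysis of a single iteration -/

section Algorithm

variable {EM : Type*} [NormedAddCommGroup EM] [NormedSpace ℝ EM] [FiniteDimensional ℝ EM]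
  {M : Type*} [EMetricSpace M] [ChartedSpace EM M]
  [IsManifold 𝓘(ℝ, EM) ∞ M] [Bundle.RiemannianBundle (fun x : M ↦ TangentSpace 𝓘(ℝ, EM) x)]
  {g : M → ℝ} {R : TangentBundle 𝓘(ℝ, EM) M → M} {Φ : M → M} {P : Parameters}
  {y : M} {γ : ℝ} {s : TangentSpace 𝓘(ℝ, EM) y}

theorem radius_nonneg (hγ : 0 ≤ γ) : 0 ≤ radius g R y γ := by
  unfold radius
  split_ifs <;> positivity

theorem exists_isCauchyDirection (g : M → ℝ) (R : TangentBundle 𝓘(ℝ, EM) M → M) (y : M) :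
    ∃ u, IsCauchyDirection g R y u := by
  by_cases h : IsEigenvalueStep g R y
  · obtain ⟨u, hu, hTu⟩ := exists_eigenvector_of_sInf_neg h.1
    rcases le_total (inner ℝ u (riemannianGradient EM g y)) 0 with h0 | h0
    · exact ⟨u, fun _ ↦ ⟨hu, hTu, h0⟩, fun h' ↦ absurd h h'⟩
    · refine ⟨-u, fun _ ↦ ⟨by rwa [norm_neg], ?_, by rw [inner_neg_left]; linarith⟩,
        fun h' ↦ absurd h h'⟩
      rw [map_neg, smul_neg]
      exact congrArg Neg.neg hTu
  · exact ⟨_, fun h' ↦ absurd h' h, fun _ ↦ rfl⟩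

theorem continuous_model (g : M → ℝ) (R : TangentBundle 𝓘(ℝ, EM) M → M) (y : M) :
    Continuous (model g R y) :=
  (continuous_const.add (continuous_id.inner continuous_const)).add
    (continuous_const.mul (continuous_id.inner (pullbackHessian g R y).continuous))

theorem exists_isTrialStep (g : M → ℝ) (R : TangentBundle 𝓘(ℝ, EM) M → M) (y : M) (hγ : 0 < γ) :
    ∃ s, IsTrialStep g R y γ s := by
  obtain ⟨u, hu⟩ := exists_isCauchyDirection g R y
  have hr : 0 ≤ radius g R y γ := radius_nonneg hγ.le
  suffices ∃ t : ℝ, 0 ≤ t ∧ ‖t • u‖ ≤ radius g R y γ ∧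
      ∀ t' : ℝ, 0 ≤ t' → ‖t' • u‖ ≤ radius g R y γ → model g R y (t • u) ≤ model g R y (t' • u) by
    obtain ⟨t, h0, h1, h2⟩ := this
    exact ⟨t • u, h1, t • u, ⟨u, t, hu, rfl, h0, h1, h2⟩, le_rfl⟩
  rcases eq_or_ne u 0 with rfl | hu0
  · exact ⟨0, le_rfl, by simpa using hr, fun t' _ _ ↦ by simp⟩
  have hn : 0 < ‖u‖ := norm_pos_iff.2 hu0
  have hcont : Continuous fun t : ℝ ↦ model g R y (t • u) :=
    (continuous_model g R y).comp (continuous_id.smul continuous_const)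
  have hiff : ∀ t : ℝ, 0 ≤ t → (‖t • u‖ ≤ radius g R y γ ↔ t ≤ radius g R y γ / ‖u‖) := by
    intro t ht
    rw [norm_smul, Real.norm_of_nonneg ht, le_div_iff₀ hn]
  obtain ⟨t, ht, hmin⟩ := (isCompact_Icc (a := (0 : ℝ)) (b := radius g R y γ / ‖u‖)).exists_isMinOn
    ⟨0, le_rfl, by positivity⟩ hcont.continuousOn
  exact ⟨t, ht.1, (hiff t ht.1).2 ht.2, fun t' h0 h1 ↦ hmin ⟨h0, (hiff t' h0).1 h1⟩⟩

theorem IsTrialStep.exists_model_le (hs : IsTrialStep g R y γ s) :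
    ∃ u, IsCauchyDirection g R y u ∧
      ∀ t : ℝ, 0 ≤ t → ‖t • u‖ ≤ radius g R y γ → model g R y s ≤ model g R y (t • u) := by
  obtain ⟨-, sc, ⟨u, t, hu, rfl, -, -, hmin⟩, hle⟩ := hs
  exact ⟨u, hu, fun t' h0 h1 ↦ hle.trans (hmin t' h0 h1)⟩

theorem IsTrialStep.model_le (hs : IsTrialStep g R y γ s) (hγ : 0 ≤ γ) :
    model g R y s ≤ model g R y 0 := by
  obtain ⟨u, -, h⟩ := hs.exists_model_le
  simpa using h 0 le_rfl (by simpa using radius_nonneg hγ)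

theorem radius_of_isEigenvalueStep (h : IsEigenvalueStep g R y) :
    radius g R y γ = γ * -leastEigenvalue g R y := by
  rw [radius, if_pos h, min_eq_left h.1.le, abs_of_neg h.1]

theorem IsEigenvalueStep.sq_lt (h : IsEigenvalueStep g R y) :
    ‖riemannianGradient EM g y‖ ^ 2 < (-leastEigenvalue g R y) ^ 3 := by
  have := h.2
  rwa [min_eq_left h.1.le, abs_of_neg h.1] at this

/-- Model decrease in an iteration on the gradient. -/
theorem IsTrialStep.gradient_decrease (hg : ContMDiff 𝓘(ℝ, EM) 𝓘(ℝ, ℝ) 2 g) (hR : IsRetraction R)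
    (hs : IsTrialStep g R y γ s) (h : ¬ IsEigenvalueStep g R y) {C τ : ℝ}
    (hC : ∀ v : TangentSpace 𝓘(ℝ, EM) y, |inner ℝ v (pullbackHessian g R y v)| ≤ C * ‖v‖ ^ 2)
    (hτ : 0 ≤ τ) (hτγ : τ ≤ γ) (hτC : τ * C ≤ 1) :
    1 / 2 * τ * ‖riemannianGradient EM g y‖ ^ 2 ≤ model g R y 0 - model g R y s := by
  obtain ⟨u, hu, hle⟩ := hs.exists_model_le
  obtain rfl := hu.2 h
  set G := riemannianGradient EM g y with hG
  -- Compare with the gradient step of length parameter `τ ≤ γ`, which fits in the radius; `τ * C ≤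
  -- 1` lets the quadratic term cost at most half of the linear gain.
  have h1 := hle τ hτ (by
    rw [radius, if_neg h, norm_smul, norm_neg, Real.norm_of_nonneg hτ]
    gcongr)
  have h2 : model g R y (τ • -G) ≤ g y - τ * ‖G‖ ^ 2 + 1 / 2 * (τ ^ 2 * (C * ‖G‖ ^ 2)) := by
    rw [model_eq hg hR, ← hG]
    have k1 : inner ℝ (τ • -G) G = -(τ * ‖G‖ ^ 2) := by
      rw [real_inner_smul_left, inner_neg_left, real_inner_self_eq_norm_sq]
      ring
    have k2 : inner ℝ (τ • -G) (pullbackHessian g R y (τ • -G)) =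
        τ ^ 2 * inner ℝ G (pullbackHessian g R y G) := by
      rw [map_smul, map_neg, real_inner_smul_left, real_inner_smul_right, inner_neg_neg]
      ring
    rw [k1, k2]
    have k3 := mul_le_mul_of_nonneg_left ((le_abs_self _).trans (hC G)) (sq_nonneg τ)
    linarith
  rw [model_zero]
  have h3 : 0 ≤ τ * ‖G‖ ^ 2 * (1 - τ * C) :=
    mul_nonneg (by positivity) (by linarith)
  nlinarith

/-- Model decrease in an iteration on the eigenvalue. -/
theorem IsTrialStep.eigenvalue_decrease (hg : ContMDiff 𝓘(ℝ, EM) 𝓘(ℝ, ℝ) 2 g)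
    (hR : IsRetraction R) (hs : IsTrialStep g R y γ s) (h : IsEigenvalueStep g R y) {τ : ℝ}
    (hτ : 0 ≤ τ) (hτγ : τ ≤ γ) :
    1 / 2 * τ ^ 2 * (-leastEigenvalue g R y) ^ 3 ≤ model g R y 0 - model g R y s := by
  obtain ⟨u, hu, hle⟩ := hs.exists_model_le
  obtain ⟨hu1, hHu, huG⟩ := hu.1 h
  set l := leastEigenvalue g R y with hl
  have hl0 : 0 < -l := neg_pos.2 h.1
  -- Along the unit eigenvector, the point at distance `τ * -l` fits in the radius `γ * -l`; the
  -- linear term is nonpositive by the choice of sign.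
  have h1 := hle (τ * -l) (by positivity) (by
    rw [radius_of_isEigenvalueStep h, norm_smul, hu1, mul_one, Real.norm_of_nonneg (by positivity)]
    gcongr)
  have h2 : model g R y ((τ * -l) • u) ≤ g y + 1 / 2 * ((τ * -l) ^ 2 * l) := by
    rw [model_eq hg hR, map_smul, hHu]
    simp only [real_inner_smul_left, real_inner_smul_right, real_inner_self_eq_norm_sq, hu1]
    have := mul_nonpos_of_nonneg_of_nonpos (show 0 ≤ τ * -l by positivity) huG
    linarith
  rw [model_zero]
  linarith

variable [IsContMDiffRiemannianBundle 𝓘(ℝ, EM) ∞ EM (fun x : M ↦ TangentSpace 𝓘(ℝ, EM) x)]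

/-- An eigenvalue step always has positive model decrease, and a gradient step without decrease has
zero gradient, hence zero radius. This makes the convention `ρ = 1` harmless. -/
theorem IsTrialStep.eq_zero_of_model_eq (hg : ContMDiff 𝓘(ℝ, EM) 𝓘(ℝ, ℝ) 2 g)
    (hR : IsRetraction R) (hγ : 0 < γ) (hs : IsTrialStep g R y γ s)
    (h0 : model g R y 0 - model g R y s = 0) : s = 0 := by
  by_cases h : IsEigenvalueStep g R y
  · have h1 := hs.eigenvalue_decrease hg hR h hγ.le le_rfl
    have h2 : 0 < -leastEigenvalue g R y := neg_pos.2 h.1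
    have h3 : 0 < 1 / 2 * γ ^ 2 * (-leastEigenvalue g R y) ^ 3 := by positivity
    linarith
  · obtain ⟨C, hC, hev⟩ := exists_eventually_norm_le hg hR y
    have hτ : 0 < min γ (1 / C) := by positivity
    have h1 := hs.gradient_decrease hg hR h hev.self_of_nhds.2 hτ.le (min_le_left _ _)
      (by rw [← le_div_iff₀ hC]; exact min_le_right _ _)
    have h2 : ‖riemannianGradient EM g y‖ = 0 := by
      by_contra hne
      have : 0 < 1 / 2 * min γ (1 / C) * ‖riemannianGradient EM g y‖ ^ 2 := by positivity
      linarith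
    have h3 := hs.1
    rw [radius, if_neg h, h2, mul_zero] at h3
    exact norm_le_zero_iff.1 h3

theorem IsTrialStep.decrease_of_success (hg : ContMDiff 𝓘(ℝ, EM) 𝓘(ℝ, ℝ) 2 g)
    (hR : IsRetraction R) (hγ : 0 < γ) (hs : IsTrialStep g R y γ s) {η : ℝ}
    (hη : η ≤ decreaseRatio g R y s) :
    g (R ⟨y, s⟩) ≤ g y - η * (model g R y 0 - model g R y s) := by
  by_cases h0 : model g R y 0 - model g R y s = 0
  · obtain rfl := hs.eq_zero_of_model_eq hg hR hγ h0
    simp [hR.apply_zero]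
  · have h1 : 0 < model g R y 0 - model g R y s :=
      lt_of_le_of_ne (sub_nonneg.2 (hs.model_le hγ.le)) (Ne.symm h0)
    rw [decreaseRatio, if_neg h0, le_div_iff₀ h1] at hη
    linarith

theorem le_decreaseRatio_of_abs_sub_model_le {η : ℝ} (hη : η ≤ 1)
    (hle : model g R y s ≤ model g R y 0)
    (h : |g (R ⟨y, s⟩) - model g R y s| ≤ (1 - η) * (model g R y 0 - model g R y s)) :
    η ≤ decreaseRatio g R y s := by
  rw [decreaseRatio]
  split_ifs with h0
  · exact hη
  · rw [le_div_iff₀ (lt_of_le_of_ne (sub_nonneg.2 hle) (Ne.symm h0))]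
    have := (abs_le.1 h).2
    rw [model_zero] at *
    linarith

/-- Near a point where the gradient does not vanish or the Hessian is not positive semidefinite,
trial steps for small enough `γ` are successful, and the model decrease is bounded below in terms
of a lower bound for `γ`. -/
theorem exists_eventually_success (hg : ContMDiff 𝓘(ℝ, EM) 𝓘(ℝ, ℝ) 2 g) (hR : IsRetraction R)
    {η : ℝ} (hη : η < 1) {z : M}
    (hz : ¬ (riemannianGradient EM g z = 0 ∧
      ∀ u : TangentSpace 𝓘(ℝ, EM) z, 0 ≤ inner ℝ u (pullbackHessian g R z u))) :
    ∃ γs > 0, ∀ γlo > 0, ∃ κ > 0, ∀ᶠ y in 𝓝 z, ∀ (γ : ℝ) (s : TangentSpace 𝓘(ℝ, EM) y),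
      0 < γ → IsTrialStep g R y γ s →
        (γ ≤ γs → η ≤ decreaseRatio g R y s) ∧
        (γlo ≤ γ → κ ≤ model g R y 0 - model g R y s) := by
  have hlow : ∃ c > 0, ∀ᶠ y in 𝓝 z, c ≤ ‖riemannianGradient EM g y‖ ∨
      leastEigenvalue g R y ≤ -c := by
    by_cases h1 : riemannianGradient EM g z = 0
    · obtain ⟨u, hu⟩ : ∃ u : TangentSpace 𝓘(ℝ, EM) z,
          inner ℝ u (pullbackHessian g R z u) < 0 := by
        by_contra! hcon
        exact hz ⟨h1, hcon⟩
      obtain ⟨c, hc, h⟩ := exists_eventually_leastEigenvalue_le hg hR hu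
      exact ⟨c, hc, h.mono fun y hy ↦ Or.inr hy⟩
    · obtain ⟨c, hc, h⟩ := exists_eventually_le_norm_gradient hg hR h1
      exact ⟨c, hc, h.mono fun y hy ↦ Or.inl hy⟩
  obtain ⟨c, hc, hlow⟩ := hlow
  obtain ⟨C, hC, hnorm⟩ := exists_eventually_norm_le hg hR z
  -- The step test always selects the dominant quantity: whichever of gradient and eigenvalue is
  -- bounded below by `c`, the one in use (`‖∇g‖ ^ 2` or `|λ| ^ 3`) is at least `a`.
  set a := min (c ^ 2) (c ^ 3) with ha
  have ha0 : 0 < a := by positivity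
  set b := min 1 a with hb
  have hb0 : 0 < b := by positivity
  have hη' : 0 < 1 - η := by linarith
  -- The error `ε * δ ^ 2` must stay below `1 - η` times the decrease. For eigenvalue steps this
  -- needs `b ≤ |λ|`, for gradient steps `b * γ ≤ 1`.
  set ε := (1 - η) * b / 2 with hε
  have hε0 : 0 < ε := by positivity
  obtain ⟨r, hr, hmodel⟩ := exists_eventually_abs_sub_model_le hg hR z hε0
  have hgrad : ∀ᶠ y in 𝓝 z, ¬ IsEigenvalueStep g R y → a ≤ ‖riemannianGradient EM g y‖ ^ 2 := by
    filter_upwards [hlow] with y hy h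
    rcases hy with hy | hy
    · exact (min_le_left _ _).trans (by gcongr)
    · have hl : leastEigenvalue g R y < 0 := by linarith
      have h2 : ¬ ‖riemannianGradient EM g y‖ ^ 2 < |min (leastEigenvalue g R y) 0| ^ 3 :=
        fun h' ↦ h ⟨hl, h'⟩
      rw [min_eq_left hl.le, abs_of_neg hl, not_lt] at h2
      refine (min_le_right _ _).trans (le_trans ?_ h2)
      gcongr
      linarith
  have heig : ∀ᶠ y in 𝓝 z, IsEigenvalueStep g R y → a ≤ (-leastEigenvalue g R y) ^ 3 := by
    filter_upwards [hlow] with y hy h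
    rcases hy with hy | hy
    · exact (min_le_left _ _).trans (le_trans (by gcongr) h.sq_lt.le)
    · refine (min_le_right _ _).trans ?_
      gcongr
      linarith
  have hbC : ∀ y, (∀ v : TangentSpace 𝓘(ℝ, EM) y,
      |inner ℝ v (pullbackHessian g R y v)| ≤ C * ‖v‖ ^ 2) → IsEigenvalueStep g R y →
      -leastEigenvalue g R y ≤ C := by
    intro y hy h
    obtain ⟨u, hu, hTu⟩ := exists_eigenvector_of_sInf_neg h.1
    have h1 := hy u
    have h2 : inner ℝ u (pullbackHessian g R y u) = leastEigenvalue g R y := by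
      have : pullbackHessian g R y u = leastEigenvalue g R y • u := hTu
      rw [this, real_inner_smul_right, real_inner_self_eq_norm_sq, hu]
      simp
    rw [h2, hu] at h1
    simpa using (neg_le_abs _).trans h1
  -- The three bounds give `b * γ ≤ 1`, `γ * C ≤ 1` and radius below `r`, the radius being at most
  -- `γ * C`; the factor `2` makes the last one strict.
  refine ⟨min (min 1 (1 / C)) (r / (2 * C)), by positivity, fun γlo hγlo ↦ ?_⟩
  -- No upper bound on `γ` is available here, so the comparison step is truncated at `1 / C`.
  set τ := min γlo (1 / C) with hτ
  have hτ0 : 0 < τ := by positivity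
  have hτC : τ * C ≤ 1 := by
    rw [← le_div_iff₀ hC]
    exact min_le_right _ _
  refine ⟨min (1 / 2 * τ * a) (1 / 2 * τ ^ 2 * a), by positivity, ?_⟩
  filter_upwards [hnorm, hmodel, hgrad, heig] with y ⟨hn1, hn2⟩ hmodel hgrad heig γ s hγ hs
  refine ⟨fun hγs ↦ ?_, fun hγlo ↦ ?_⟩
  · have hγ1 : γ ≤ 1 := hγs.trans ((min_le_left _ _).trans (min_le_left _ _))
    have hγC : γ * C ≤ 1 := by
      rw [← le_div_iff₀ hC]
      exact hγs.trans ((min_le_left _ _).trans (min_le_right _ _))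
    have hγr : γ * C < r := by
      have := hγs.trans (min_le_right _ _)
      rw [le_div_iff₀ (by positivity)] at this
      linarith
    have hsr : ‖s‖ < r := by
      refine lt_of_le_of_lt (hs.1.trans ?_) hγr
      by_cases h : IsEigenvalueStep g R y
      · rw [radius_of_isEigenvalueStep h]
        gcongr
        exact hbC y hn2 h
      · rw [radius, if_neg h]
        gcongr
    refine le_decreaseRatio_of_abs_sub_model_le hη.le (hs.model_le hγ.le)
      ((hmodel s hsr).trans ?_)
    have hs2 : ‖s‖ ^ 2 ≤ radius g R y γ ^ 2 := by
      gcongr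
      exact hs.1
    refine (mul_le_mul_of_nonneg_left hs2 hε0.le).trans ?_
    by_cases h : IsEigenvalueStep g R y
    · have hl0 : 0 < -leastEigenvalue g R y := neg_pos.2 h.1
      -- Either `|λ| ≥ 1`, or `|λ| ≥ |λ| ^ 3 ≥ a`.
      have hbl : b ≤ -leastEigenvalue g R y := by
        rcases le_total 1 (-leastEigenvalue g R y) with h1 | h1
        · exact (min_le_left _ _).trans h1
        · refine (min_le_right _ _).trans ((heig h).trans ?_)
          exact pow_le_of_le_one hl0.le h1 (by norm_num)
      refine le_trans ?_ (mul_le_mul_of_nonneg_left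
        (hs.eigenvalue_decrease hg hR h hγ.le le_rfl) hη'.le)
      rw [radius_of_isEigenvalueStep h, hε]
      calc (1 - η) * b / 2 * (γ * -leastEigenvalue g R y) ^ 2
          = (1 - η) * (1 / 2 * γ ^ 2 * (-leastEigenvalue g R y) ^ 2) * b := by ring
        _ ≤ (1 - η) * (1 / 2 * γ ^ 2 * (-leastEigenvalue g R y) ^ 2) *
            -leastEigenvalue g R y := by gcongr
        _ = _ := by ring
    · refine le_trans ?_ (mul_le_mul_of_nonneg_left
        (hs.gradient_decrease hg hR h hn2 hγ.le le_rfl hγC) hη'.le)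
      rw [radius, if_neg h, hε]
      have hb1 : b ≤ 1 := min_le_left _ _
      calc (1 - η) * b / 2 * (γ * ‖riemannianGradient EM g y‖) ^ 2
          = (1 - η) * (1 / 2 * γ * ‖riemannianGradient EM g y‖ ^ 2) * (b * γ) := by ring
        _ ≤ (1 - η) * (1 / 2 * γ * ‖riemannianGradient EM g y‖ ^ 2) * 1 := by
            gcongr
            exact mul_le_one₀ hb1 hγ.le hγ1
        _ = _ := by ring
  · have hτγ : τ ≤ γ := (min_le_left _ _).trans hγlo
    by_cases h : IsEigenvalueStep g R y
    · refine (min_le_right _ _).trans (le_trans ?_ (hs.eigenvalue_decrease hg hR h hτ0.le hτγ))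
      gcongr
      exact heig h
    · refine (min_le_left _ _).trans
        (le_trans ?_ (hs.gradient_decrease hg hR h hn2 hτ0.le hτγ hτC))
      gcongr
      exact hgrad h

end Algorithm

/-! ### Runs of the algorithm -/

section Runs

variable {EM : Type*} [NormedAddCommGroup EM] [NormedSpace ℝ EM] [FiniteDimensional ℝ EM]
  {M : Type*} [EMetricSpace M] [ChartedSpace EM M]
  [IsManifold 𝓘(ℝ, EM) ∞ M] [Bundle.RiemannianBundle (fun x : M ↦ TangentSpace 𝓘(ℝ, EM) x)]

theorem exists_isRun (P : Parameters) (g : M → ℝ) (R : TangentBundle 𝓘(ℝ, EM) M → M) (Φ : M → M)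
    (yin : M) {γin : ℝ} (hγin : 0 < γin) : ∃ y γ s, IsRun P g R Φ yin γin y γ s := by
  classical
  choose S hS using fun (y : M) (γ : {γ : ℝ // 0 < γ}) ↦ exists_isTrialStep g R y γ.2
  -- The state carries positivity of `γ`, on which the choice of trial steps relies; after a success
  -- `γ` is reset to `P.γlo`.
  let next : M × {γ : ℝ // 0 < γ} → M × {γ : ℝ // 0 < γ} := fun p ↦
    if P.η ≤ decreaseRatio g R p.1 (S p.1 p.2) then
      (Φ (R ⟨p.1, S p.1 p.2⟩), ⟨P.γlo, P.γlo_pos⟩)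
    else (p.1, ⟨P.γc * p.2, mul_pos P.γc_mem.1 p.2.2⟩)
  let st : ℕ → M × {γ : ℝ // 0 < γ} := fun k ↦ next^[k] (Φ yin, ⟨γin, hγin⟩)
  have hst : ∀ k, st (k + 1) = next (st k) := fun k ↦ Function.iterate_succ_apply' _ _ _
  refine ⟨fun k ↦ (st k).1, fun k ↦ (st k).2, fun k ↦ S (st k).1 (st k).2, rfl, rfl,
    fun k ↦ hS _ _, fun k hk ↦ ?_, fun k hk ↦ ?_⟩
  · have : next (st k) = (Φ (R ⟨(st k).1, S (st k).1 (st k).2⟩), ⟨P.γlo, P.γlo_pos⟩) := if_pos hk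
    rw [hst, this]
    exact ⟨rfl, le_rfl, P.γlo_le⟩
  · have : next (st k) = ((st k).1, ⟨P.γc * (st k).2, mul_pos P.γc_mem.1 (st k).2.2⟩) := if_neg hk
    rw [hst, this]
    exact ⟨rfl, rfl⟩

variable {P : Parameters} {g : M → ℝ} {R : TangentBundle 𝓘(ℝ, EM) M → M} {Φ : M → M}
  {yin : M} {γin : ℝ} {y : ℕ → M} {γ : ℕ → ℝ} {s : ∀ k, TangentSpace 𝓘(ℝ, EM) (y k)}

theorem IsRun.gamma_pos (h : IsRun P g R Φ yin γin y γ s) (hγin : 0 < γin) (k : ℕ) : 0 < γ k := by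
  induction k with
  | zero => rwa [h.γ_zero]
  | succ k ih =>
    by_cases hk : P.η ≤ decreaseRatio g R (y k) (s k)
    · exact P.γlo_pos.trans_le (h.success k hk).2.1
    · rw [(h.failure k hk).2]
      exact mul_pos P.γc_mem.1 ih

variable [IsContMDiffRiemannianBundle 𝓘(ℝ, EM) ∞ EM (fun x : M ↦ TangentSpace 𝓘(ℝ, EM) x)]

theorem IsRun.retraction_le (h : IsRun P g R Φ yin γin y γ s) (hγin : 0 < γin)
    (hg : ContMDiff 𝓘(ℝ, EM) 𝓘(ℝ, ℝ) 2 g) (hR : IsRetraction R) {k : ℕ}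
    (hk : P.η ≤ decreaseRatio g R (y k) (s k)) : g (R ⟨y k, s k⟩) ≤ g (y k) := by
  have h1 := (h.trial k).decrease_of_success hg hR (h.gamma_pos hγin k) hk
  have h2 := mul_nonneg P.η_mem.1.le
    (sub_nonneg.2 ((h.trial k).model_le (h.gamma_pos hγin k).le))
  linarith

theorem IsRun.antitone (h : IsRun P g R Φ yin γin y γ s) (hγin : 0 < γin)
    (hg : ContMDiff 𝓘(ℝ, EM) 𝓘(ℝ, ℝ) 2 g) (hR : IsRetraction R) (hΦ : ∀ w, g (Φ w) = g w) :
    Antitone fun k ↦ g (y k) := by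
  refine antitone_nat_of_succ_le fun k ↦ ?_
  by_cases hk : P.η ≤ decreaseRatio g R (y k) (s k)
  · rw [(h.success k hk).1, hΦ]
    exact h.retraction_le hγin hg hR hk
  · rw [(h.failure k hk).1]

/-- All iterates of a run are images under the hook of points of the initial sublevel set. -/
theorem IsRun.mem_image_sublevel (h : IsRun P g R Φ yin γin y γ s) (hγin : 0 < γin)
    (hg : ContMDiff 𝓘(ℝ, EM) 𝓘(ℝ, ℝ) 2 g) (hR : IsRetraction R) (hΦ : ∀ w, g (Φ w) = g w) (k : ℕ) :
    y k ∈ Φ '' {w | g w ≤ g yin} := by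
  induction k with
  | zero => exact ⟨yin, le_refl (g yin), h.y_zero.symm⟩
  | succ k ih =>
    by_cases hk : P.η ≤ decreaseRatio g R (y k) (s k)
    · refine ⟨_, ?_, (h.success k hk).1.symm⟩
      have h1 := h.antitone hγin hg hR hΦ (Nat.zero_le k)
      simp only [h.y_zero, hΦ] at h1
      exact (h.retraction_le hγin hg hR hk).trans h1
    · rwa [(h.failure k hk).1]

/-- Were `f (x k)` below `f z`, continuity would make infinitely many later values exceed `f (x k)`.
-/
theorem _root_.Antitone.le_of_mapClusterPt {X : Type*} [TopologicalSpace X] {f : X → ℝ} {x : ℕ → X}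
    {z : X} (hf : ContinuousAt f z) (ha : Antitone fun k ↦ f (x k))
    (hz : MapClusterPt z Filter.atTop x) (k : ℕ) : f z ≤ f (x k) := by
  by_contra! hcon
  have h1 : ∃ᶠ j in Filter.atTop, f (x k) < f (x j) :=
    hz.frequently (hf.eventually (lt_mem_nhds hcon))
  obtain ⟨j, hj, hkj⟩ := (h1.and_eventually (Filter.eventually_ge_atTop k)).exists
  exact absurd (ha hkj) (not_le.2 hj)

theorem IsRun.isTwoCritical_of_mapClusterPt (h : IsRun P g R Φ yin γin y γ s)
    (hγin : P.γlo ≤ γin) (hg : ContMDiff 𝓘(ℝ, EM) 𝓘(ℝ, ℝ) 2 g) (hR : IsRetraction R)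
    (hΦ : ∀ w, g (Φ w) = g w) {z : M} (hz : MapClusterPt z Filter.atTop y) :
    IsTwoCritical EM g z := by
  by_contra hcrit
  have hγpos := h.gamma_pos (P.γlo_pos.trans_le hγin)
  have hanti := h.antitone (P.γlo_pos.trans_le hγin) hg hR hΦ
  obtain ⟨γs, hγs, H⟩ := exists_eventually_success hg hR P.η_mem.2
    (fun h' ↦ hcrit (isTwoCritical_of_nonneg hg hR h'.1 h'.2))
  have hγc := P.γc_mem.1
  have hγlo := P.γlo_pos
  obtain ⟨κ, hκ, hev⟩ := H (min P.γlo (P.γc * γs)) (by positivity)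
  set V := {w : M | ∀ (γ : ℝ) (s : TangentSpace 𝓘(ℝ, EM) w), 0 < γ → IsTrialStep g R w γ s →
    (γ ≤ γs → P.η ≤ decreaseRatio g R w s) ∧
    (min P.γlo (P.γc * γs) ≤ γ → κ ≤ model g R w 0 - model g R w s)} with hV
  have hsucc : ∀ k, y k ∈ V → γ k ≤ γs → P.η ≤ decreaseRatio g R (y k) (s k) :=
    fun k hk ↦ (hk _ _ (hγpos k) (h.trial k)).1
  -- Initially and after a success `γ` is at least `P.γlo`. After a failure the previous iterate is
  -- the same point of `V`, so the previous `γ` exceeded `γs`.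
  have hγmin : ∀ k, y k ∈ V → min P.γlo (P.γc * γs) ≤ γ k := by
    rintro (_ | k) hk
    · rw [h.γ_zero]
      exact (min_le_left _ _).trans hγin
    · by_cases hs : P.η ≤ decreaseRatio g R (y k) (s k)
      · exact (min_le_left _ _).trans (h.success k hs).2.1
      · obtain ⟨hy, hγ⟩ := h.failure k hs
        rw [hy] at hk
        rw [hγ]
        refine (min_le_right _ _).trans ?_
        gcongr
        by_contra! hlt
        exact hs (hsucc k hk hlt.le)
  -- Otherwise the run stays at `y k` while `γ` shrinks geometrically, until it falls below `γs` and
  -- success is forced.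
  have hexists : ∀ k, y k ∈ V → ∃ j, y j = y k ∧ P.η ≤ decreaseRatio g R (y j) (s j) := by
    intro k hk
    by_contra! hcon
    have hstay : ∀ n, y (k + n) = y k ∧ γ (k + n) = P.γc ^ n * γ k := by
      intro n
      induction n with
      | zero => simp
      | succ n ih =>
        obtain ⟨hy, hγ⟩ := h.failure (k + n) (not_le.2 (hcon _ ih.1))
        refine ⟨hy.trans ih.1, hγ.trans ?_⟩
        rw [ih.2]
        ring
    obtain ⟨n, hn⟩ := exists_pow_lt_of_lt_one (div_pos hγs (hγpos k)) P.γc_mem.2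
    rw [lt_div_iff₀ (hγpos k), ← (hstay n).2] at hn
    exact absurd (hsucc (k + n) (by rwa [(hstay n).1]) hn.le) (not_le.2 (hcon _ (hstay n).1))
  have hcont : ContinuousAt g z := hg.continuous.continuousAt
  have hηκ : 0 < P.η * κ := mul_pos P.η_mem.1 hκ
  have hfreq : ∃ᶠ k in Filter.atTop, y k ∈ V ∧ g (y k) < g z + P.η * κ :=
    hz.frequently (hev.and (hcont.eventually (gt_mem_nhds (lt_add_of_pos_right _ hηκ))))
  obtain ⟨k, hkV, hk⟩ := hfreq.exists
  obtain ⟨j, hj, hjs⟩ := hexists k hkV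
  have hjV : y j ∈ V := by rwa [hj]
  have h1 := (h.trial j).decrease_of_success hg hR (hγpos j) hjs
  have h2 := (hjV _ _ (hγpos j) (h.trial j)).2 (hγmin j hjV)
  -- The contradiction: the success at `j` lowers the value by at least `P.η * κ`, from below `g z +
  -- P.η * κ`.
  have h3 : g z ≤ g (y (j + 1)) := hanti.le_of_mapClusterPt hcont hz _
  rw [(h.success j hjs).1, hΦ] at h3
  have h4 := mul_le_mul_of_nonneg_left h2 P.η_mem.1.le
  rw [hj] at h1 h3 h4
  linarith

end Runs

end HookedTrustRegion

end

/-! ### Assembly of the theorem -/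

theorem mainTheorem6
    -- the complete Riemannian manifold `M`
    {EM : Type*} [NormedAddCommGroup EM] [NormedSpace ℝ EM] [FiniteDimensional ℝ EM]
    {M : Type*} [EMetricSpace M] [ChartedSpace EM M] [IsManifold 𝓘(ℝ, EM) ∞ M]
    [Bundle.RiemannianBundle (fun x : M ↦ TangentSpace 𝓘(ℝ, EM) x)]
    [IsContMDiffRiemannianBundle 𝓘(ℝ, EM) ∞ EM (fun x : M ↦ TangentSpace 𝓘(ℝ, EM) x)]
    [IsRiemannianManifold 𝓘(ℝ, EM) M] [CompleteSpace M]
    -- the Euclidean space `E`, the lift `φ` of its image, the retraction and the hook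
    {E : Type*} [NormedAddCommGroup E] [InnerProductSpace ℝ E] [FiniteDimensional ℝ E]
    (φ : M → E) (hφ : ContMDiff 𝓘(ℝ, EM) 𝓘(ℝ, E) ∞ φ)
    (R : TangentBundle 𝓘(ℝ, EM) M → M) (hR : HookedTrustRegion.IsRetraction R)
    (Φ : M → M) (hΦ : HookedTrustRegion.IsRebalancingMap φ Φ)
    -- the cost function, three times continuously differentiable near the image of `φ`
    (f : E → ℝ) (U : Set E) (hU : IsOpen U) (hφU : Set.range φ ⊆ U) (hf : ContDiffOn ℝ 3 f U)
    (x₀ : E) (hbdd : Bornology.IsBounded {x | x ∈ Set.range φ ∧ f x ≤ f x₀})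
    -- the parameters and the input of the algorithm
    (P : HookedTrustRegion.Parameters) (yin : M) (hyin : φ yin = x₀)
    (γin : ℝ) (hγin : γin ∈ Set.Icc P.γlo P.γhi) :
    (∃ (y : ℕ → M) (γ : ℕ → ℝ) (s : ∀ k, TangentSpace 𝓘(ℝ, EM) (y k)),
      HookedTrustRegion.IsRun P (f ∘ φ) R Φ yin γin y γ s) ∧
    ∀ (y : ℕ → M) (γ : ℕ → ℝ) (s : ∀ k, TangentSpace 𝓘(ℝ, EM) (y k)),
      HookedTrustRegion.IsRun P (f ∘ φ) R Φ yin γin y γ s →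
      (∃ z : M, MapClusterPt z Filter.atTop y) ∧
      ∀ z : M, MapClusterPt z Filter.atTop y →
        HookedTrustRegion.IsTwoCritical EM (f ∘ φ) z := by
  have hg : ContMDiff 𝓘(ℝ, EM) 𝓘(ℝ, ℝ) 2 (f ∘ φ) := by
    intro y
    have h1 : ContDiffAt ℝ 2 f (φ y) :=
      (hf.contDiffAt (hU.mem_nhds (hφU ⟨y, rfl⟩))).of_le (by norm_num)
    exact h1.contMDiffAt.comp y ((hφ y).of_le ENat.LEInfty.out)
  have hΦg : ∀ w, (f ∘ φ) (Φ w) = (f ∘ φ) w := fun w ↦ congrArg f (congrFun hΦ.comp_eq w)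
  have hγpos : 0 < γin := P.γlo_pos.trans_le hγin.1
  refine ⟨HookedTrustRegion.exists_isRun P (f ∘ φ) R Φ yin hγpos, fun y γ s h ↦
    ⟨?_, fun z hz ↦ h.isTwoCritical_of_mapClusterPt hγin.1 hg hR hΦg hz⟩⟩
  -- The preimage of the sublevel set under `φ` may be unbounded; only its image under `Φ` is
  -- confined, and every iterate, `y 0` included, lies in that image.
  obtain ⟨K, hK, hSK⟩ := (hΦ.bounded _ (fun x hx ↦ hx.1) hbdd).exists_isCompact_superset EM
  have hmem : ∀ k, y k ∈ K := by
    intro k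
    obtain ⟨w, hw, hwk⟩ := h.mem_image_sublevel hγpos hg hR hΦg k
    refine hSK ⟨w, ⟨⟨w, rfl⟩, ?_⟩, hwk⟩
    rw [← hyin]
    exact hw
  obtain ⟨z, -, hz⟩ := hK.exists_mapClusterPt (f := Filter.atTop) (u := y)
    (Filter.tendsto_principal.2 (Filter.Eventually.of_forall hmem))
  exact ⟨z, hz⟩
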